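/- Let $\tau=\tau_1+i\tau_2$ with $\tau_2>0$, let $z\in\mathbb C$, and write $z=\alpha\tau+\beta$ with $\alpha,\beta\in\mathbb R$. For $m\ge 0$ put $$c_{\alpha,m}:=\frac1{(2\pi)^2}\sum_{\ell\ge1}\cos(2\pi\ell\alpha)\int_0^\infty e^{-\ell^2x-\frac{\pi^2m^2}{x}}\,dx,$$ $$Z_{\alpha,\beta,m}(\tau):=e^{-8\pi c_{\alpha,m}\tau_2}\prod_{n\in\mathbb Z}\prod_{\pm}\Bigl(1-e^{-2\pi\tau_2\sqrt{m^2+(n\pm\alpha)^2}+2\pi i(n\pm\alpha)\tau_1\pm2\pi i\beta}\Bigr)$$ (the plane-wave fermion partition function), and for $\mu\ge0$ define the massive torus amplitude, with mass $m=\sqrt{\mu/\tau_2}$, by $$\mathcal E_{1,\mu}(z;\tau):=-\operatorname{Log}Z_{\alpha,\beta,\sqrt{\mu/\tau_2}}(\tau),$$ where $\operatorname{Log}$ is the principal logarithm. For $w>0$ let $K_1(w)=\frac12\cdot\frac w2\int_0^\infty e^{-x-\frac{w^2}{4x}}x^{-2}\,dx$. (a) For every $\mu>0$ the series and the product defining $Z_{\alpha,\beta,\sqrt{\mu/\tau_2}}(\tau)$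 converge absolutely, this number is nonzero, the following double series converges absolutely, and $$\mathcal E_{1,\mu}(z;\tau)=2\sqrt{\mu\tau_2}\sum_{(r,\ell)\in\mathbb Z^2\setminus\{(0,0)\}}\frac{K_1\bigl(2\pi\sqrt{\mu/\tau_2}\,|r\tau+\ell|\bigr)}{|r\tau+\ell|}\,e^{\frac{2\pi i}{\tau_2}\operatorname{Im}((r\tau+\ell)\overline z)}.$$ (b) Suppose $z\notin\mathbb Z\tau+\mathbb Z$. Then the Kronecker-Eisenstein series $$\mathbb E_s(z;\tau)=\Gamma(s)\Bigl(\frac{\tau_2}{\pi}\Bigr)^s\sum_{(r,\ell)\in\mathbb Z^2\setminus\{(0,0)\}}\frac{e^{\frac{2\pi i}{\tau_2}\operatorname{Im}((r\tau+\ell)\overline z)}}{|r\tau+\ell|^{2s}},$$ which converges absolutely for $\operatorname{Re}(s)>1$, continues analytically in $s$ to $\operatorname{Re}(s)>0$. With $\mathbb E_1(z;\tau)$ the value of this continuation at $s=1$, $$\lim_{\mu\to0^+}\mathcal E_{1,\mu}(z;\tau)=\mathbb E_1(z;\tau).$$ Moreover $Z_{\alpha,\beta,0}(\tau)$ is also well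 defined (convergent in the sense of (a)) and nonzero, and $\mathcal E_{1,0}(z;\tau)=\mathbb E_1(z;\tau)$. -/

import Mathlib

open Complex Filter Topology MeasureTheory
open scoped UpperHalfPlane ComplexConjugate

namespace MassiveTorus

noncomputable section

/-- The `K`-Bessel function
`K_ν(w) = ½ (w/2)^ν ∫₀^∞ exp(-x - w²/(4x)) x^{-ν-1} dx`, for real order and `w > 0`. -/
def besselK (ν w : ℝ) : ℝ :=
  1 / 2 * (w / 2) ^ ν *
    ∫ x in Set.Ioi (0 : ℝ), Real.exp (-x - w ^ 2 / (4 * x)) * x ^ (-ν - 1)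

/-- The term with index `ℓ + 1` of the series defining the Casimir energy `c_{α,m}`. -/
def casimirTerm (α m : ℝ) (ℓ : ℕ) : ℝ :=
  Real.cos (2 * Real.pi * ((ℓ : ℝ) + 1) * α) *
    ∫ x in Set.Ioi (0 : ℝ),
      Real.exp (-((ℓ : ℝ) + 1) ^ 2 * x - Real.pi ^ 2 * m ^ 2 / x)

/-- `c_{α,m} = (2π)⁻² ∑_{ℓ ≥ 1} cos(2πℓα) ∫₀^∞ exp(-ℓ²x - π²m²/x) dx`. -/
def casimir (α m : ℝ) : ℝ :=
  1 / (2 * Real.pi) ^ 2 * ∑' ℓ : ℕ, casimirTerm α m ℓ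

/-- `1 - exp(-2πτ₂ √(m² + (n + εα)²) + 2πi (n + εα) τ₁ + ε 2πi β)`, used with `ε = ±1`. -/
def fermionFactor (α β m : ℝ) (τ : ℍ) (n : ℤ) (ε : ℝ) : ℂ :=
  1 - cexp (((-2 * Real.pi * τ.im * √(m ^ 2 + ((n : ℝ) + ε * α) ^ 2) : ℝ) : ℂ)
    + 2 * Real.pi * I * (((n : ℝ) + ε * α : ℝ) : ℂ) * (τ.re : ℂ)
    + (ε : ℂ) * (2 * Real.pi * I * (β : ℂ)))

/-- The product over the two signs `±` of the factors with index `n`. -/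
def fermionFactorPair (α β m : ℝ) (τ : ℍ) (n : ℤ) : ℂ :=
  fermionFactor α β m τ n 1 * fermionFactor α β m τ n (-1)

/-- The plane-wave fermion partition function
`Z_{α,β,m}(τ) = exp(-8π c_{α,m} τ₂) ∏_{n ∈ ℤ} ∏_± (1 - exp(…))`. -/
def partitionFunction (α β m : ℝ) (τ : ℍ) : ℂ :=
  cexp ((-8 * Real.pi * casimir α m * τ.im : ℝ) : ℂ) *
    ∏' n : ℤ, fermionFactorPair α β m τ n

/-- The series and the product defining `Z_{α,β,m}(τ)` converge, and `Z_{α,β,m}(τ) ≠ 0`,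
so that its logarithm is meaningful. -/
def PartitionFunctionWellDefined (α β m : ℝ) (τ : ℍ) : Prop :=
  Summable (casimirTerm α m) ∧ Multipliable (fermionFactorPair α β m τ) ∧
    partitionFunction α β m τ ≠ 0

/-- The real coordinate `α` in `z = ατ + β`. -/
def coordAlpha (z : ℂ) (τ : ℍ) : ℝ := z.im / τ.im

/-- The real coordinate `β` in `z = ατ + β`. -/
def coordBeta (z : ℂ) (τ : ℍ) : ℝ := z.re - coordAlpha z τ * τ.re

theorem coord_spec (z : ℂ) (τ : ℍ) :
    (coordAlpha z τ : ℂ) * (τ : ℂ) + (coordBeta z τ : ℂ) = z := by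
  have h : τ.im ≠ 0 := τ.im_ne_zero
  apply Complex.ext
  · simp [coordBeta]
  · simp [coordAlpha, h]

/-- The mass `m` with `μ = m² τ₂`. -/
def massOf (μ : ℝ) (τ : ℍ) : ℝ := √(μ / τ.im)

/-- The massive torus amplitude `𝓔_{1,μ}(z;τ) = -Log Z_{α,β,m}(τ)`,
where `z = ατ + β` and `μ = m² τ₂` (principal branch of the logarithm). -/
def massiveE1 (μ : ℝ) (z : ℂ) (τ : ℍ) : ℂ :=
  -Complex.log (partitionFunction (coordAlpha z τ) (coordBeta z τ) (massOf μ τ) τ)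

/-- The index set `ℤ² \ {(0,0)}`. -/
abbrev LatticeIndex : Type := {p : ℤ × ℤ // p ≠ 0}

/-- The lattice point `rτ + ℓ` for `p = (r, ℓ)`. -/
def latticePoint (τ : ℍ) (p : ℤ × ℤ) : ℂ := (p.1 : ℂ) * (τ : ℂ) + (p.2 : ℂ)

/-- The character `exp((2πi/τ₂) Im((rτ + ℓ) z̄))`. -/
def latticeChar (z : ℂ) (τ : ℍ) (p : ℤ × ℤ) : ℂ :=
  cexp (2 * Real.pi * I / (τ.im : ℂ) * ((latticePoint τ p * conj z).im : ℂ))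

/-- The term `K₁(2π √(μ/τ₂) |rτ+ℓ|) / |rτ+ℓ| · exp((2πi/τ₂) Im((rτ+ℓ) z̄))`. -/
def besselTerm (μ : ℝ) (z : ℂ) (τ : ℍ) (p : LatticeIndex) : ℂ :=
  ((besselK 1 (2 * Real.pi * √(μ / τ.im) * ‖latticePoint τ p.1‖)
      / ‖latticePoint τ p.1‖ : ℝ) : ℂ) * latticeChar z τ p.1

/-- The term of index `(r, ℓ)` of the Kronecker–Eisenstein series
`𝔼_s(z;τ) = Γ(s) (τ₂/π)^s ∑ exp((2πi/τ₂) Im((rτ+ℓ) z̄)) / |rτ+ℓ|^{2s}`. -/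
def kroneckerEisensteinTerm (s : ℂ) (z : ℂ) (τ : ℍ) (p : LatticeIndex) : ℂ :=
  Complex.Gamma s * ((τ.im / Real.pi : ℝ) : ℂ) ^ s *
    (latticeChar z τ p.1 / ((‖latticePoint τ p.1‖ : ℝ) : ℂ) ^ (2 * s))

/-- `F` is the Kronecker–Eisenstein series `s ↦ 𝔼_s(z;τ)`, continued analytically to
`Re s > 0`: it is analytic there, and for `Re s > 1` it is the sum of the (absolutely
convergent) double series. In particular `F 1` is `𝔼_1(z;τ)`, whose double series is only
conditionally convergent. -/
def IsKroneckerEisenstein (z : ℂ) (τ : ℍ) (F : ℂ → ℂ) : Prop :=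
  AnalyticOnNhd ℂ F {s : ℂ | 0 < s.re} ∧
    ∀ s : ℂ, 1 < s.re → HasSum (kroneckerEisensteinTerm s z τ) (F s)

/-- The continuation is unique, so the value `𝔼_1(z;τ) = F 1` is well defined. -/
theorem IsKroneckerEisenstein.unique {z : ℂ} {τ : ℍ} {F G : ℂ → ℂ}
    (hF : IsKroneckerEisenstein z τ F) (hG : IsKroneckerEisenstein z τ G) : F 1 = G 1 := by
  have hc : IsPreconnected {s : ℂ | 0 < s.re} :=
    (convex_halfSpace_re_gt 0).isPreconnected
  have h2 : (2 : ℂ) ∈ {s : ℂ | 0 < s.re} := by simp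
  have he : F =ᶠ[𝓝 (2 : ℂ)] G := by
    have ho : {s : ℂ | 1 < s.re} ∈ 𝓝 (2 : ℂ) :=
      (isOpen_lt continuous_const Complex.continuous_re).mem_nhds (by simp)
    filter_upwards [ho] with s hs
    exact (hF.2 s hs).unique (hG.2 s hs)
  exact hF.1.eqOn_of_preconnected_of_eventuallyEq hG.1 hc h2 he (by simp)

end

end MassiveTorus

/-! Put h(μ,A) = ∫₀^∞ exp(-πμ/t - πAt) dt. The Bessel term at a lattice point p is its character
times h(μ, |p|²/τ₂), up to the prefactor (`besselK_one_eq`), so everything reduces to summing heat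
integrals over the lattice.

For (a), sum by rows r. Row 0 is the Casimir energy after rescaling t (`heatRow_zero`). For r ≠ 0,
Poisson summation in ℓ under the integral leaves a Bessel integral of order 1/2, which is elementary
(`integral_inv_sqrt_mul_exp`). With qₙ = `nome`, row r > 0 becomes ∑ₙ qₙ^r / r and row -r its
conjugate (`tsum_heatTerm_row`). Summing over r gives -2 Re ∑ₙ log(1 - qₙ). On the other side, n ↦
-n makes the minus-sign factors conjugate to the plus-sign ones, so Z = exp(-8πcτ₂) |∏ₙ(1 - qₙ)|²
(`partitionFunction_eq`). This is a positive real, so the principal logarithm meets no branch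
problem.

For (b), the amplitude is ∫₀^∞ exp(-πμ/t) θ(t) dt, where θ is the lattice theta series without its
origin term. It decays faster than any power at infinity. A double Poisson summation writes θ + 1 as
t⁻¹ ∑ₚ exp(-π|p+z|²/(τ₂t)), so θ stays bounded near 0 when z is not a lattice point
(`thetaSeries_bounded`). Hence the Mellin transform of θ continues 𝔼_s to Re s > 0, and dominated
convergence as μ → 0 gives its value at 1. Separately, Z is continuous as the mass tends to 0 and
its massless value is positive, so the two limits of the amplitude agree. -/

namespace MassiveTorus

/-! ### Heat integrals and their bounds -/

/-- The integral `∫₀^∞ exp(-πμ/t - πAt) dt`. -/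
noncomputable def heatIntegral (μ A : ℝ) : ℝ :=
  ∫ t in Set.Ioi (0 : ℝ), Real.exp (-Real.pi * μ / t - Real.pi * A * t)

theorem integrableOn_exp_neg_mul {A : ℝ} (hA : 0 < A) :
    IntegrableOn (fun t : ℝ => Real.exp (-Real.pi * A * t)) (Set.Ioi 0) := by
  have := integrableOn_exp_mul_Ioi (a := -Real.pi * A) (by nlinarith [Real.pi_pos]) 0
  exact this

theorem exp_heat_le {μ A t : ℝ} (hμ : 0 ≤ μ) (ht : 0 < t) :
    Real.exp (-Real.pi * μ / t - Real.pi * A * t) ≤ Real.exp (-Real.pi * A * t) := by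
  apply Real.exp_le_exp.mpr
  have : 0 ≤ Real.pi * μ / t := by positivity
  have h2 : -Real.pi * μ / t = -(Real.pi * μ / t) := by ring
  rw [h2]; linarith

theorem integrableOn_heat {μ A : ℝ} (hμ : 0 ≤ μ) (hA : 0 < A) :
    IntegrableOn (fun t : ℝ => Real.exp (-Real.pi * μ / t - Real.pi * A * t)) (Set.Ioi 0) := by
  refine (integrableOn_exp_neg_mul hA).mono' (by fun_prop) ?_
  filter_upwards [ae_restrict_mem measurableSet_Ioi] with t ht
  rw [Real.norm_of_nonneg (Real.exp_pos _).le]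
  exact exp_heat_le hμ ht

theorem heatIntegral_nonneg (μ A : ℝ) : 0 ≤ heatIntegral μ A :=
  integral_nonneg fun _ => (Real.exp_pos _).le

theorem heatIntegral_zero {A : ℝ} (hA : 0 < A) : heatIntegral 0 A = 1 / (Real.pi * A) := by
  have := integral_exp_mul_Ioi (a := -Real.pi * A) (by nlinarith [Real.pi_pos]) 0
  simp only [heatIntegral, mul_zero, zero_div, zero_sub]
  simp only [← neg_mul]
  rw [this]
  have : Real.pi ≠ 0 := Real.pi_ne_zero
  simp

theorem heatIntegral_le {μ A : ℝ} (hμ : 0 ≤ μ) (hA : 0 < A) :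
    heatIntegral μ A ≤ 1 / (Real.pi * A) := by
  rw [← heatIntegral_zero hA]
  refine setIntegral_mono_on (integrableOn_heat hμ hA) (integrableOn_heat le_rfl hA)
    measurableSet_Ioi fun t ht => ?_
  refine (exp_heat_le hμ ht).trans_eq ?_
  simp

/-- The bound 1/(πA) gives only |p|⁻², not summable over the lattice. Using exp(-y) ≤ 1/y on the
mass factor gains a second power of 1/A, hence |p|⁻⁴, at the cost of uniformity in μ. -/
theorem heatIntegral_le_sq {μ A : ℝ} (hμ : 0 < μ) (hA : 0 < A) :
    heatIntegral μ A ≤ 1 / (Real.pi * μ) * (1 / (Real.pi * A)) ^ 2 := by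
  have hπ := Real.pi_pos
  have hG := Real.integral_rpow_mul_exp_neg_mul_Ioi (a := 2) (r := Real.pi * A) (by norm_num)
    (by positivity)
  have hint : IntegrableOn (fun t : ℝ => t ^ ((2 : ℝ) - 1) * Real.exp (-(Real.pi * A * t)))
      (Set.Ioi 0) := by
    -- A non-integrable function has integral 0 by convention, while the Gamma integral is positive.
    by_contra h
    rw [integral_undef h, Real.Gamma_two] at hG
    have : (0 : ℝ) < (1 / (Real.pi * A)) ^ (2 : ℝ) * 1 := by positivity
    linarith
  rw [Real.Gamma_two, mul_one] at hG
  rw [← Real.rpow_natCast (1 / (Real.pi * A)) 2, Nat.cast_ofNat, ← hG, ← integral_const_mul]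
  refine setIntegral_mono_on (integrableOn_heat hμ.le hA) (hint.const_mul _)
    measurableSet_Ioi fun t ht => ?_
  have ht : 0 < t := ht
  have h1 : (2 : ℝ) - 1 = 1 := by norm_num
  rw [h1, Real.rpow_one, sub_eq_add_neg, Real.exp_add, ← mul_assoc]
  refine mul_le_mul_of_nonneg_right ?_ (Real.exp_pos _).le
  have h2 : 1 / (Real.pi * μ) * t = (Real.pi * μ / t)⁻¹ := by field_simp
  have h3 : -Real.pi * μ / t = -(Real.pi * μ / t) := by ring
  rw [h2, h3, Real.exp_neg]
  have h4 : 0 < Real.pi * μ / t := by positivity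
  exact inv_anti₀ h4 (by linarith [Real.add_one_le_exp (Real.pi * μ / t)])

theorem tendsto_heatIntegral {A : ℝ} (hA : 0 < A) :
    Tendsto (fun μ => heatIntegral μ A) (𝓝[>] 0) (𝓝 (heatIntegral 0 A)) := by
  refine tendsto_integral_filter_of_dominated_convergence
    (fun t => Real.exp (-Real.pi * A * t)) (Eventually.of_forall fun μ => by fun_prop) ?_
    (integrableOn_exp_neg_mul hA) ?_
  · filter_upwards [self_mem_nhdsWithin] with μ hμ
    filter_upwards [ae_restrict_mem measurableSet_Ioi] with t ht
    rw [Real.norm_of_nonneg (Real.exp_pos _).le]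
    exact exp_heat_le (le_of_lt hμ) ht
  · refine Eventually.of_forall fun t => ?_
    have : Continuous fun μ : ℝ => Real.exp (-Real.pi * μ / t - Real.pi * A * t) := by fun_prop
    exact (this.tendsto 0).mono_left nhdsWithin_le_nhds

/-! ### Casimir terms and K₁ as heat integrals -/

theorem integral_Ioi_comp_inv (g : ℝ → ℝ) :
    ∫ x in Set.Ioi (0 : ℝ), (x ^ 2)⁻¹ * g x⁻¹ = ∫ y in Set.Ioi (0 : ℝ), g y := by
  rw [← integral_comp_rpow_Ioi g (p := -1) (by norm_num)]
  refine setIntegral_congr_fun measurableSet_Ioi fun x hx => ?_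
  have hx : 0 < x := hx
  have h1 : (-1 : ℝ) - 1 = -((2 : ℕ) : ℝ) := by norm_num
  simp only [abs_neg, abs_one, one_mul, smul_eq_mul]
  rw [h1, Real.rpow_neg hx.le, Real.rpow_natCast, Real.rpow_neg_one]

theorem integral_Ioi_comp_mul (g : ℝ → ℝ) {c : ℝ} (hc : 0 < c) :
    ∫ y in Set.Ioi (0 : ℝ), g y = c * ∫ t in Set.Ioi (0 : ℝ), g (c * t) := by
  have := integral_comp_mul_left_Ioi g 0 hc
  rw [this, mul_zero, smul_eq_mul, mul_inv_cancel_left₀ hc.ne']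

/-- The scale T is free: T = τ₂ matches the row r = 0 of the lattice, T = 1 gives bounds independent
of τ. -/
theorem casimirTerm_eq (α m : ℝ) (ℓ : ℕ) {T : ℝ} (hT : 0 < T) :
    casimirTerm α m ℓ = Real.cos (2 * Real.pi * ((ℓ : ℝ) + 1) * α) *
      (Real.pi / T * heatIntegral (m ^ 2 * T) (((ℓ : ℝ) + 1) ^ 2 / T)) := by
  have hπ := Real.pi_pos
  rw [casimirTerm, heatIntegral, integral_Ioi_comp_mul _ (c := Real.pi / T) (by positivity)]
  congr 2
  refine setIntegral_congr_fun measurableSet_Ioi fun t ht => ?_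
  have ht : 0 < t := ht
  congr 1
  field_simp
  ring

/-- Substitute x = πμ/t in the Bessel integral. -/
theorem besselK_one_eq {μ T N : ℝ} (hμ : 0 < μ) (hT : 0 < T) (hN : 0 < N) :
    2 * √(μ * T) * (besselK 1 (2 * Real.pi * √(μ / T) * N) / N) =
      heatIntegral μ (N ^ 2 / T) := by
  have hπ := Real.pi_pos
  have hs : √(μ * T) * √(μ / T) = μ := by
    rw [← Real.sqrt_mul (by positivity)]
    rw [show μ * T * (μ / T) = μ ^ 2 by field_simp, Real.sqrt_sq hμ.le]
  have hs2 : √(μ / T) ^ 2 = μ / T := Real.sq_sqrt (by positivity)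
  have h1 : ∫ x in Set.Ioi (0 : ℝ), Real.exp (-x - (2 * Real.pi * √(μ / T) * N) ^ 2 / (4 * x))
      * x ^ (-(1 : ℝ) - 1) = 1 / (Real.pi * μ) * heatIntegral μ (N ^ 2 / T) := by
    set g : ℝ → ℝ := fun y => Real.exp (-y⁻¹ - Real.pi ^ 2 * (μ / T) * N ^ 2 * y) with hg
    have h2 : ∫ x in Set.Ioi (0 : ℝ),
        Real.exp (-x - (2 * Real.pi * √(μ / T) * N) ^ 2 / (4 * x)) * x ^ (-(1 : ℝ) - 1)
        = ∫ x in Set.Ioi (0 : ℝ), (x ^ 2)⁻¹ * g x⁻¹ := by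
      refine setIntegral_congr_fun measurableSet_Ioi fun x hx => ?_
      have hx : 0 < x := hx
      have h1 : -(1 : ℝ) - 1 = -((2 : ℕ) : ℝ) := by norm_num
      simp only [hg]
      rw [h1, Real.rpow_neg hx.le, Real.rpow_natCast, mul_comm, inv_inv]
      congr 3
      rw [mul_pow, mul_pow, hs2]
      field_simp
      ring
    rw [h2, integral_Ioi_comp_inv, integral_Ioi_comp_mul g (c := 1 / (Real.pi * μ)) (by positivity),
      heatIntegral]
    congr 1
    refine setIntegral_congr_fun measurableSet_Ioi fun t ht => ?_
    have ht : 0 < t := ht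
    simp only [hg]
    congr 1
    field_simp
  rw [besselK, h1, Real.rpow_one]
  have : 2 * √(μ * T) * (1 / 2 * (2 * Real.pi * √(μ / T) * N / 2) *
      (1 / (Real.pi * μ) * heatIntegral μ (N ^ 2 / T)) / N)
      = (√(μ * T) * √(μ / T)) * (1 / μ) * heatIntegral μ (N ^ 2 / T) := by
    field_simp
  rw [this, hs]
  field_simp

/-! ### The elementary Bessel integral of order 1/2 -/

theorem image_mul_sub_div_Ioi {a b : ℝ} (ha : 0 < a) (hb : 0 < b) :
    (fun u : ℝ => a * u - b / u) '' Set.Ioi 0 = Set.univ := by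
  refine Set.eq_univ_of_forall fun v => ?_
  have hd : 0 ≤ v ^ 2 + 4 * a * b := by positivity
  have hlt : |v| < √(v ^ 2 + 4 * a * b) := by
    apply Real.lt_sqrt_of_sq_lt
    rw [sq_abs]
    nlinarith [mul_pos ha hb]
  have hpos : 0 < v + √(v ^ 2 + 4 * a * b) := by linarith [neg_abs_le v]
  -- The positive root of a u² - v u - b = 0.
  refine ⟨(v + √(v ^ 2 + 4 * a * b)) / (2 * a), div_pos hpos (by positivity), ?_⟩
  have hsq := Real.sq_sqrt hd
  set s := √(v ^ 2 + 4 * a * b)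
  have := hpos.ne'
  dsimp only
  field_simp
  nlinarith

theorem injOn_mul_sub_div {a b : ℝ} (ha : 0 < a) (hb : 0 < b) :
    Set.InjOn (fun u : ℝ => a * u - b / u) (Set.Ioi 0) := by
  intro u hu v hv h
  have hu : 0 < u := hu
  have hv : 0 < v := hv
  dsimp only at h
  have h1 : (u - v) * (a + b / (u * v)) = 0 := by
    field_simp
    field_simp at h
    linarith
  rcases mul_eq_zero.mp h1 with h2 | h2
  · linarith
  · have : 0 < a + b / (u * v) := by positivity
    linarith

theorem hasDerivAt_mul_sub_div (a b : ℝ) {u : ℝ} (hu : 0 < u) :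
    HasDerivAt (fun u : ℝ => a * u - b / u) (a + b / u ^ 2) u := by
  have h := ((hasDerivAt_id u).const_mul a).sub ((hasDerivAt_inv hu.ne').const_mul b)
  convert! h using 1
  simp
  field_simp

/-- Cauchy–Schlömilch: v = au - b/u turns the Gaussian integral over ℝ into ∫ (a + b/u²) h(u) du
over u > 0. The involution u ↦ b/(au) preserves h and exchanges the two summands, so each
contributes half. -/
theorem integral_exp_neg_mul_sub_div_sq {a b : ℝ} (ha : 0 < a) (hb : 0 < b) :
    ∫ u in Set.Ioi (0 : ℝ), Real.exp (-(a * u - b / u) ^ 2) = √Real.pi / (2 * a) := by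
  set h : ℝ → ℝ := fun u => Real.exp (-(a * u - b / u) ^ 2) with hh
  have hgauss : ∫ v : ℝ, Real.exp (-v ^ 2) = √Real.pi := by
    simpa using integral_gaussian 1
  have hgi : Integrable fun v : ℝ => Real.exp (-v ^ 2) := by
    simpa using integrable_exp_neg_mul_sq (b := 1) one_pos
  have hder : ∀ u ∈ Set.Ioi (0 : ℝ),
      HasDerivWithinAt (fun u : ℝ => a * u - b / u) (a + b / u ^ 2) (Set.Ioi 0) u :=
    fun u hu => (hasDerivAt_mul_sub_div a b hu).hasDerivWithinAt
  have hch := integral_image_eq_integral_abs_deriv_smul measurableSet_Ioi hder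
    (injOn_mul_sub_div ha hb) (fun v => Real.exp (-v ^ 2))
  have hci := integrableOn_image_iff_integrableOn_abs_deriv_smul measurableSet_Ioi hder
    (injOn_mul_sub_div ha hb) (fun v => Real.exp (-v ^ 2))
  rw [image_mul_sub_div_Ioi ha hb] at hch hci
  rw [setIntegral_univ, hgauss] at hch
  have habs : ∀ u ∈ Set.Ioi (0 : ℝ), |a + b / u ^ 2| • Real.exp (-(a * u - b / u) ^ 2) =
      a * h u + b / u ^ 2 * h u := by
    intro u hu
    have hu : 0 < u := hu
    rw [abs_of_pos (by positivity), smul_eq_mul, add_mul]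
  rw [setIntegral_congr_fun measurableSet_Ioi habs] at hch
  have hI2 := (integrableOn_congr_fun habs measurableSet_Ioi).mp (hci.mp hgi.integrableOn)
  -- The change of variables gives integrability of the sum only; splitting it needs h itself, which
  -- is below e^{2ab} e^{-a²u²}.
  have hI1 : IntegrableOn h (Set.Ioi 0) := by
    refine (((integrable_exp_neg_mul_sq (b := a ^ 2) (by positivity)).const_mul
      (Real.exp (2 * a * b))).integrableOn).mono' (by fun_prop) ?_
    filter_upwards [ae_restrict_mem measurableSet_Ioi] with u hu
    have hu : 0 < u := hu
    rw [Real.norm_of_nonneg (Real.exp_pos _).le, ← Real.exp_add]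
    apply Real.exp_le_exp.mpr
    have h1 : (a * u - b / u) ^ 2 = a ^ 2 * u ^ 2 - 2 * a * b + (b / u) ^ 2 := by
      field_simp
      ring
    rw [h1]
    nlinarith [sq_nonneg (b / u)]
  have hI3 : IntegrableOn (fun u => b / u ^ 2 * h u) (Set.Ioi 0) := by
    refine (Integrable.sub hI2 (hI1.const_mul a)).congr (Eventually.of_forall fun u => ?_)
    simp
  rw [integral_add (hI1.const_mul a) hI3, integral_const_mul] at hch
  have hsw : ∫ u in Set.Ioi (0 : ℝ), b / u ^ 2 * h u = a * ∫ u in Set.Ioi (0 : ℝ), h u := by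
    set g : ℝ → ℝ := fun y => b * Real.exp (-(a / y - b * y) ^ 2) with hg
    have e1 : ∫ u in Set.Ioi (0 : ℝ), b / u ^ 2 * h u =
        ∫ u in Set.Ioi (0 : ℝ), (u ^ 2)⁻¹ * g u⁻¹ := by
      refine setIntegral_congr_fun measurableSet_Ioi fun u hu => ?_
      simp only [hg, hh, div_inv_eq_mul]
      ring_nf
    rw [e1, integral_Ioi_comp_inv, integral_Ioi_comp_mul g (c := a / b) (by positivity),
      ← integral_const_mul, ← integral_const_mul]
    refine setIntegral_congr_fun measurableSet_Ioi fun u hu => ?_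
    have hu : 0 < u := hu
    simp only [hg, hh]
    have e2 : (a / (a / b * u) - b * (a / b * u)) ^ 2 = (a * u - b / u) ^ 2 := by
      field_simp
      ring
    rw [e2]
    field_simp
  rw [hsw] at hch
  rw [hch]
  field_simp
  ring

theorem integrableOn_inv_sqrt_mul_exp {A B : ℝ} (hA : 0 < A) (hB : 0 ≤ B) :
    IntegrableOn (fun t : ℝ => (√t)⁻¹ * Real.exp (-B / t - A * t)) (Set.Ioi 0) := by
  have h0 := integrableOn_rpow_mul_exp_neg_mul_rpow (p := 1) (s := -1 / 2) (b := A)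
    (by norm_num) one_pos hA
  refine h0.mono' (by fun_prop) ?_
  filter_upwards [ae_restrict_mem measurableSet_Ioi] with t ht
  have ht : 0 < t := ht
  rw [Real.norm_of_nonneg (by positivity), Real.sqrt_eq_rpow, ← Real.rpow_neg ht.le, Real.rpow_one]
  norm_num
  refine mul_le_mul_of_nonneg_left (Real.exp_le_exp.mpr ?_) (by positivity)
  have : 0 ≤ B / t := by positivity
  have h2 : -B / t = -(B / t) := by ring
  linarith

/-- Put t = u² and complete the square with a = √A, b = √B. The case B = 0 is a half Gaussian, apart
because the previous substitution needs b > 0. -/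
theorem integral_inv_sqrt_mul_exp {A B : ℝ} (hA : 0 < A) (hB : 0 ≤ B) :
    ∫ t in Set.Ioi (0 : ℝ), (√t)⁻¹ * Real.exp (-B / t - A * t) =
      √(Real.pi / A) * Real.exp (-2 * √(A * B)) := by
  have h1 : ∫ t in Set.Ioi (0 : ℝ), (√t)⁻¹ * Real.exp (-B / t - A * t) =
      ∫ u in Set.Ioi (0 : ℝ), 2 * Real.exp (-B / u ^ 2 - A * u ^ 2) := by
    rw [← integral_comp_rpow_Ioi _ (p := 2) (by norm_num)]
    refine setIntegral_congr_fun measurableSet_Ioi fun u hu => ?_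
    have hu : 0 < u := hu
    have e1 : (2 : ℝ) - 1 = 1 := by norm_num
    have e2 : u ^ (2 : ℝ) = u ^ 2 := by norm_cast
    simp only [smul_eq_mul]
    rw [e1, e2, Real.sqrt_sq hu.le, Real.rpow_one, abs_of_pos two_pos]
    field_simp
  rw [h1, integral_const_mul]
  rcases hB.eq_or_lt with rfl | hB
  · have := integral_gaussian_Ioi A
    simp only [neg_zero, zero_div, zero_sub, mul_zero, Real.sqrt_zero, Real.exp_zero, mul_one]
    simp only [← neg_mul]
    rw [this]
    ring
  · have hsA : √A ^ 2 = A := Real.sq_sqrt hA.le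
    have hsB : √B ^ 2 = B := Real.sq_sqrt hB.le
    have h2 : ∫ u in Set.Ioi (0 : ℝ), Real.exp (-B / u ^ 2 - A * u ^ 2) =
        ∫ u in Set.Ioi (0 : ℝ), Real.exp (-2 * √(A * B)) * Real.exp (-(√A * u - √B / u) ^ 2) := by
      refine setIntegral_congr_fun measurableSet_Ioi fun u hu => ?_
      have hu : 0 < u := hu
      rw [← Real.exp_add, Real.sqrt_mul hA.le]
      congr 1
      have : (√A * u - √B / u) ^ 2 = √A ^ 2 * u ^ 2 - 2 * (√A * √B) + √B ^ 2 / u ^ 2 := by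
        field_simp
        ring
      rw [this, hsA, hsB]
      ring
    rw [h2, integral_const_mul, integral_exp_neg_mul_sub_div_sq (Real.sqrt_pos.mpr hA)
      (Real.sqrt_pos.mpr hB), Real.sqrt_div Real.pi_pos.le]
    have : √A ≠ 0 := (Real.sqrt_pos.mpr hA).ne'
    field_simp

/-! ### Phases and Poisson summation for Gaussians -/

/-- The phase `exp(2πiy)`. -/
noncomputable def phase (y : ℝ) : ℂ := cexp (2 * Real.pi * I * y)

@[simp] theorem norm_phase (y : ℝ) : ‖phase y‖ = 1 := by
  rw [phase, show 2 * (Real.pi : ℂ) * I * y = ((2 * Real.pi * y : ℝ) : ℂ) * I by push_cast; ring,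
    norm_exp_ofReal_mul_I]

theorem phase_add (x y : ℝ) : phase (x + y) = phase x * phase y := by
  rw [phase, phase, phase, ← Complex.exp_add]; push_cast; ring_nf

@[simp] theorem phase_zero : phase 0 = 1 := by simp [phase]

theorem conj_phase (y : ℝ) : conj (phase y) = phase (-y) := by
  simp [phase, ← Complex.exp_conj, Complex.conj_ofNat]

theorem phase_nat_mul (k : ℕ) (y : ℝ) : phase (k * y) = phase y ^ k := by
  rw [phase, phase, ← Complex.exp_nat_mul]; push_cast; ring_nf

theorem phase_re (y : ℝ) : (phase y).re = Real.cos (2 * Real.pi * y) := by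
  rw [phase, show 2 * (Real.pi : ℂ) * I * y = ((2 * Real.pi * y : ℝ) : ℂ) * I by push_cast; ring,
    exp_ofReal_mul_I_re]

theorem phase_eq_one_iff (y : ℝ) : phase y = 1 ↔ ∃ k : ℤ, y = k := by
  rw [phase, Complex.exp_eq_one_iff]
  have h : (2 * (Real.pi : ℂ) * I) ≠ 0 := two_pi_I_ne_zero
  refine exists_congr fun k => ?_
  rw [mul_comm (k : ℂ), mul_right_inj' h]
  norm_cast

theorem summable_gaussian {c : ℝ} (hc : 0 < c) (x : ℝ) :
    Summable fun n : ℤ => Real.exp (-Real.pi * c * (n + x) ^ 2) := by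
  refine (HurwitzKernelBounds.summable_f_int 0 x hc).congr fun n => ?_
  simp only [HurwitzKernelBounds.f_int, pow_zero, one_mul]
  ring_nf

/-- Expanding the square, the shift x and the character α merge into one complex linear term -cx -
iα, to which the Poisson formula for quadratic exponentials applies. -/
theorem gaussian_poisson {c : ℝ} (hc : 0 < c) (x α : ℝ) :
    ∑' ℓ : ℤ, (Real.exp (-Real.pi * c * (ℓ + x) ^ 2) : ℂ) * phase (-(ℓ * α)) =
      ((√c)⁻¹ : ℝ) * ∑' n : ℤ, (Real.exp (-Real.pi / c * (n + α) ^ 2) : ℂ) *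
        phase (x * (n + α)) := by
  have hc' : (c : ℂ) ≠ 0 := by exact_mod_cast hc.ne'
  have h := Complex.tsum_exp_neg_quadratic (a := c) (by simpa using hc) (-c * x - I * α)
  have hs : 1 / (c : ℂ) ^ (1 / 2 : ℂ) = ((√c)⁻¹ : ℝ) := by
    rw [Real.sqrt_eq_rpow, ofReal_inv, ofReal_cpow hc.le, one_div]
    norm_num
  rw [hs] at h
  have e1 : ∀ ℓ : ℤ, (Real.exp (-Real.pi * c * (ℓ + x) ^ 2) : ℂ) * phase (-(ℓ * α)) =
      cexp (-Real.pi * c * x ^ 2) *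
        cexp (-Real.pi * c * ℓ ^ 2 + 2 * Real.pi * (-c * x - I * α) * ℓ) := by
    intro ℓ
    rw [phase, ofReal_exp, ← Complex.exp_add, ← Complex.exp_add]
    congr 1
    push_cast
    ring
  have e2 : ∀ n : ℤ, (Real.exp (-Real.pi / c * (n + α) ^ 2) : ℂ) * phase (x * (n + α)) =
      cexp (-Real.pi * c * x ^ 2) * cexp (-Real.pi / c * (n + I * (-c * x - I * α)) ^ 2) := by
    intro n
    rw [phase, ofReal_exp, ← Complex.exp_add, ← Complex.exp_add]
    congr 1
    have : I * (-c * x - I * α) = α - I * c * x := by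
      linear_combination -(α : ℂ) * I_sq
    rw [this]
    push_cast
    field_simp
    linear_combination (c : ℂ) ^ 2 * x ^ 2 * I_sq
  simp_rw [e1, e2, tsum_mul_left]
  rw [h]
  ring

/-! ### Lattice points, nomes and the terms of the double series -/

theorem latticeChar_eq (z : ℂ) (τ : ℍ) (p : ℤ × ℤ) :
    latticeChar z τ p = phase (p.1 * coordBeta z τ - p.2 * coordAlpha z τ) := by
  have hτ : τ.im ≠ 0 := τ.im_ne_zero
  rw [latticeChar, phase]
  have : (latticePoint τ p * conj z).im =
      τ.im * (p.1 * coordBeta z τ - p.2 * coordAlpha z τ) := by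
    simp only [latticePoint, coordBeta, coordAlpha]
    simp
    field_simp
    ring
  rw [this]
  have hτ' : (τ.im : ℂ) ≠ 0 := by exact_mod_cast hτ
  congr 1
  push_cast
  field_simp

theorem norm_latticePoint_sq (τ : ℍ) (p : ℤ × ℤ) :
    ‖latticePoint τ p‖ ^ 2 = (p.2 + p.1 * τ.re) ^ 2 + p.1 ^ 2 * τ.im ^ 2 := by
  rw [Complex.sq_norm, normSq_apply]
  simp [latticePoint]
  ring

theorem latticePoint_ne_zero (τ : ℍ) {p : ℤ × ℤ} (hp : p ≠ 0) : latticePoint τ p ≠ 0 := by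
  intro h
  have h1 := norm_latticePoint_sq τ p
  rw [h, norm_zero] at h1
  have hτ := τ.im_pos
  have h2 : (p.1 : ℝ) = 0 := by
    by_contra h0
    have : 0 < (p.1 : ℝ) ^ 2 * τ.im ^ 2 := by positivity
    nlinarith [sq_nonneg ((p.2 : ℝ) + p.1 * τ.re)]
  rw [h2] at h1
  have h3 : (p.2 : ℝ) = 0 := by
    have : (p.2 : ℝ) ^ 2 = 0 := by linarith
    exact pow_eq_zero_iff two_ne_zero |>.mp this
  exact hp (Prod.ext (by exact_mod_cast h2) (by exact_mod_cast h3))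

/-- The exponential weight `exp(-2πτ₂ √(m² + (n+α)²) + 2πi((n+α)τ₁ + β))`. -/
noncomputable def nome (α β m : ℝ) (τ : ℍ) (n : ℤ) : ℂ :=
  (Real.exp (-2 * Real.pi * τ.im * √(m ^ 2 + (n + α) ^ 2)) : ℂ) * phase ((n + α) * τ.re + β)

/-- The term of index `(r, ℓ)` of the double series for the massive amplitude. -/
noncomputable def heatTerm (μ α β : ℝ) (τ : ℍ) (p : ℤ × ℤ) : ℂ :=
  phase (p.1 * β - p.2 * α) * (heatIntegral μ (‖latticePoint τ p‖ ^ 2 / τ.im) : ℝ)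

theorem norm_heatTerm (μ α β : ℝ) (τ : ℍ) (p : ℤ × ℤ) :
    ‖heatTerm μ α β τ p‖ = heatIntegral μ (‖latticePoint τ p‖ ^ 2 / τ.im) := by
  rw [heatTerm, norm_mul, norm_phase, one_mul, norm_real,
    Real.norm_of_nonneg (heatIntegral_nonneg _ _)]

theorem summable_heatIntegral_row {μ : ℝ} (hμ : 0 ≤ μ) (τ : ℍ) {r : ℤ} (hr : r ≠ 0) :
    Summable fun ℓ : ℤ => heatIntegral μ (‖latticePoint τ (r, ℓ)‖ ^ 2 / τ.im) := by
  have hτ := τ.im_pos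
  have h := ((EisensteinSeries.linear_right_summable (τ : ℂ) r le_rfl).norm).mul_left
    (τ.im / Real.pi)
  refine h.of_nonneg_of_le (fun ℓ => heatIntegral_nonneg _ _) fun ℓ => ?_
  have hne : 0 < ‖latticePoint τ (r, ℓ)‖ :=
    norm_pos_iff.mpr (latticePoint_ne_zero τ fun h => hr (congrArg Prod.fst h))
  refine (heatIntegral_le hμ (by positivity)).trans_eq ?_
  have : (r : ℂ) * τ + ℓ = latticePoint τ (r, ℓ) := rfl
  rw [this, norm_inv, zpow_ofNat, norm_pow]
  field_simp

theorem integrableOn_heat_ofReal {μ A : ℝ} (hμ : 0 ≤ μ) (hA : 0 < A) (w : ℂ) :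
    IntegrableOn (fun t : ℝ => w * (Real.exp (-Real.pi * μ / t - Real.pi * A * t) : ℝ))
      (Set.Ioi 0) :=
  (integrableOn_heat hμ hA).ofReal.const_mul w

theorem integral_heat_ofReal (μ A : ℝ) (w : ℂ) :
    ∫ t in Set.Ioi (0 : ℝ), w * (Real.exp (-Real.pi * μ / t - Real.pi * A * t) : ℝ) =
      w * (heatIntegral μ A : ℝ) := by
  rw [integral_const_mul, integral_complex_ofReal, heatIntegral]

theorem integral_norm_heat_ofReal (μ A : ℝ) {w : ℂ} (hw : ‖w‖ = 1) :
    ∫ t in Set.Ioi (0 : ℝ), ‖w * (Real.exp (-Real.pi * μ / t - Real.pi * A * t) : ℝ)‖ =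
      heatIntegral μ A := by
  simp_rw [norm_mul, hw, one_mul, norm_real, Real.norm_of_nonneg (Real.exp_pos _).le]
  rfl

theorem norm_nome (α β m : ℝ) (τ : ℍ) (n : ℤ) :
    ‖nome α β m τ n‖ = Real.exp (-2 * Real.pi * τ.im * √(m ^ 2 + (n + α) ^ 2)) := by
  rw [nome, norm_mul, norm_phase, mul_one, norm_real, Real.norm_of_nonneg (Real.exp_pos _).le]

/-- The bound does not involve m, so it also dominates the product in the limit m → 0. -/
theorem norm_nome_le (α β m : ℝ) (τ : ℍ) (n : ℤ) :
    ‖nome α β m τ n‖ ≤ Real.exp (-2 * Real.pi * τ.im * |n + α|) := by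
  have hτ := τ.im_pos
  rw [norm_nome]
  apply Real.exp_le_exp.mpr
  have : |n + α| ≤ √(m ^ 2 + (n + α) ^ 2) := by
    apply Real.abs_le_sqrt
    nlinarith [sq_nonneg m]
  have hp : 0 < 2 * Real.pi * τ.im := by positivity
  nlinarith

theorem summable_exp_neg_abs {c : ℝ} (hc : 0 < c) (α : ℝ) :
    Summable fun n : ℤ => Real.exp (-c * |n + α|) := by
  have h1 : Summable fun n : ℤ => Real.exp (-c * |(n : ℝ)|) := by
    have hg : Summable fun n : ℕ => Real.exp (n * -c) :=
      Real.summable_exp_nat_mul_iff.mpr (by linarith)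
    refine summable_int_iff_summable_nat_and_neg.mpr ⟨?_, ?_⟩ <;>
    · refine hg.congr fun n => ?_
      simp [mul_comm]
  refine (h1.mul_left (Real.exp (c * |α|))).of_nonneg_of_le (fun _ => (Real.exp_pos _).le)
    fun n => ?_
  rw [← Real.exp_add]
  apply Real.exp_le_exp.mpr
  have : |(n : ℝ)| ≤ |n + α| + |α| := by
    have := abs_sub_abs_le_abs_sub (n : ℝ) (-α)
    rw [abs_neg, sub_neg_eq_add] at this
    linarith
  nlinarith

theorem summable_nome_bound (α : ℝ) (τ : ℍ) :
    Summable fun n : ℤ => Real.exp (-2 * Real.pi * τ.im * |n + α|) := by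
  have hτ := τ.im_pos
  refine (summable_exp_neg_abs (c := 2 * Real.pi * τ.im) (by positivity) α).congr fun n => ?_
  ring_nf

theorem summable_norm_nome (α β m : ℝ) (τ : ℍ) : Summable fun n => ‖nome α β m τ n‖ :=
  (summable_nome_bound α τ).of_nonneg_of_le (fun _ => norm_nonneg _) (norm_nome_le α β m τ)

theorem norm_nome_le_one (α β m : ℝ) (τ : ℍ) (n : ℤ) : ‖nome α β m τ n‖ ≤ 1 := by
  have hτ := τ.im_pos
  refine (norm_nome_le α β m τ n).trans (Real.exp_le_one_iff.mpr ?_)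
  have : 0 ≤ 2 * Real.pi * τ.im * |n + α| := by positivity
  linarith

theorem norm_nome_lt_one (α β : ℝ) {m : ℝ} (hm : 0 < m) (τ : ℍ) (n : ℤ) :
    ‖nome α β m τ n‖ < 1 := by
  have hτ := τ.im_pos
  rw [norm_nome, Real.exp_lt_one_iff]
  have : 0 < √(m ^ 2 + (n + α) ^ 2) := by positivity
  have : 0 < 2 * Real.pi * τ.im * √(m ^ 2 + (n + α) ^ 2) := by positivity
  linarith

/-! ### Poisson resummation of a row -/

/-- The `n`-th term of the dual sum attached to the row `r` of the lattice. -/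
noncomputable def dualTerm (α β m : ℝ) (τ : ℍ) (r n : ℤ) : ℂ :=
  ((|(r : ℝ)|⁻¹ * Real.exp (-2 * Real.pi * τ.im * (|(r : ℝ)| * √(m ^ 2 + (n + α) ^ 2))) : ℝ) : ℂ) *
    phase (r * ((n + α) * τ.re + β))

/-- The source of the infinite product: for k ≥ 1 the dual terms are the Taylor terms of -log(1 - q)
at q = `nome`. -/
theorem dualTerm_natCast (α β m : ℝ) (τ : ℍ) (k : ℕ) (n : ℤ) :
    dualTerm α β m τ k n = nome α β m τ n ^ k / k := by
  have h : ((k : ℤ) : ℝ) = (k : ℝ) := by norm_cast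
  rw [dualTerm, nome, h, phase_nat_mul, Nat.abs_cast, mul_pow, ← ofReal_pow, ← Real.exp_nat_mul]
  have : (-2 * Real.pi * τ.im * (k * √(m ^ 2 + (n + α) ^ 2))) =
      k * (-2 * Real.pi * τ.im * √(m ^ 2 + (n + α) ^ 2)) := by ring
  rw [this]
  push_cast
  ring

theorem dualTerm_neg (α β m : ℝ) (τ : ℍ) (r n : ℤ) :
    dualTerm α β m τ (-r) n = conj (dualTerm α β m τ r n) := by
  rw [dualTerm, dualTerm, map_mul, conj_ofReal, conj_phase, Int.cast_neg, abs_neg, neg_mul (r : ℝ)]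

theorem dualTerm_neg_natCast (α β m : ℝ) (τ : ℍ) (k : ℕ) (n : ℤ) :
    dualTerm α β m τ (-k) n = conj (nome α β m τ n ^ k / k) := by
  rw [dualTerm_neg, dualTerm_natCast]

theorem norm_dualTerm_le (α β m : ℝ) (τ : ℍ) {r : ℤ} (hr : r ≠ 0) (n : ℤ) :
    ‖dualTerm α β m τ r n‖ ≤ ‖nome α β m τ n‖ := by
  have key : ∀ k : ℕ, k ≠ 0 → ‖nome α β m τ n ^ k / (k : ℂ)‖ ≤ ‖nome α β m τ n‖ := by
    intro k hk
    have h1 : (1 : ℝ) ≤ k := by exact_mod_cast Nat.one_le_iff_ne_zero.mpr hk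
    rw [norm_div, norm_pow, norm_natCast]
    exact (div_le_self (by positivity) h1).trans
      (pow_le_of_le_one (norm_nonneg _) (norm_nome_le_one α β m τ n) hk)
  obtain ⟨k, rfl | rfl⟩ := r.eq_nat_or_neg
  · rw [dualTerm_natCast]
    exact key k (by simpa using hr)
  · rw [dualTerm_neg_natCast, RCLike.norm_conj]
    exact key k (by simpa using hr)

theorem summable_dualTerm (α β m : ℝ) (τ : ℍ) {r : ℤ} (hr : r ≠ 0) :
    Summable (dualTerm α β m τ r) :=
  (summable_norm_nome α β m τ).of_norm_bounded (norm_dualTerm_le α β m τ hr)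

/-- Poisson in ℓ at fixed t, with c = t/τ₂ and shift rτ₁; the mass factor is a spectator. The case μ
= 0 serves again for the theta series. -/
theorem heat_row_eq {τ : ℍ} {t : ℝ} (ht : 0 < t) (r : ℤ) (μ α β : ℝ) :
    ∑' ℓ : ℤ, phase (r * β - ℓ * α) *
        (Real.exp (-Real.pi * μ / t - Real.pi * (‖latticePoint τ (r, ℓ)‖ ^ 2 / τ.im) * t) : ℝ) =
      ∑' n : ℤ, (√τ.im : ℂ) * phase (r * ((n + α) * τ.re + β)) *
        (((√t)⁻¹ * Real.exp (-(Real.pi * (τ.im * (n + α) ^ 2 + μ)) / t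
          - Real.pi * r ^ 2 * τ.im * t) : ℝ) : ℂ) := by
  have hτ := τ.im_pos
  have hP := gaussian_poisson (c := t / τ.im) (by positivity) (r * τ.re) α
  have hs : (√(t / τ.im))⁻¹ = √τ.im * (√t)⁻¹ := by
    rw [Real.sqrt_div ht.le, inv_div, div_eq_mul_inv]
  rw [hs] at hP
  have e1 : ∀ ℓ : ℤ, phase (r * β - ℓ * α) *
        (Real.exp (-Real.pi * μ / t - Real.pi * (‖latticePoint τ (r, ℓ)‖ ^ 2 / τ.im) * t) : ℝ) =
      (phase (r * β) * (Real.exp (-Real.pi * μ / t - Real.pi * r ^ 2 * τ.im * t) : ℝ)) *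
        ((Real.exp (-Real.pi * (t / τ.im) * (ℓ + r * τ.re) ^ 2) : ℂ) * phase (-(ℓ * α))) := by
    intro ℓ
    rw [sub_eq_add_neg, phase_add, norm_latticePoint_sq]
    have : -Real.pi * μ / t - Real.pi * ((ℓ + r * τ.re) ^ 2 + r ^ 2 * τ.im ^ 2) / τ.im * t =
        (-Real.pi * μ / t - Real.pi * r ^ 2 * τ.im * t) +
          -Real.pi * (t / τ.im) * (ℓ + r * τ.re) ^ 2 := by
      field_simp
      ring
    rw [← mul_div_assoc, this, Real.exp_add]
    push_cast
    ring
  have e2 : ∀ n : ℤ, (√τ.im : ℂ) * phase (r * ((n + α) * τ.re + β)) *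
        (((√t)⁻¹ * Real.exp (-(Real.pi * (τ.im * (n + α) ^ 2 + μ)) / t
          - Real.pi * r ^ 2 * τ.im * t) : ℝ) : ℂ) =
      (phase (r * β) * (Real.exp (-Real.pi * μ / t - Real.pi * r ^ 2 * τ.im * t) : ℝ)) *
        (((√τ.im * (√t)⁻¹ : ℝ) : ℂ) *
        ((Real.exp (-Real.pi / (t / τ.im) * (n + α) ^ 2) : ℂ) * phase (r * τ.re * (n + α)))) := by
    intro n
    have h1 : r * ((n + α) * τ.re + β) = r * β + r * τ.re * (n + α) := by ring
    have h2 : -(Real.pi * (τ.im * (n + α) ^ 2 + μ)) / t - Real.pi * r ^ 2 * τ.im * t =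
        (-Real.pi * μ / t - Real.pi * r ^ 2 * τ.im * t) +
          -Real.pi / (t / τ.im) * (n + α) ^ 2 := by
      field_simp
      ring
    rw [h1, phase_add, h2, Real.exp_add]
    push_cast
    ring
  simp_rw [e1, e2, tsum_mul_left]
  rw [hP]

/-- Integrate the pointwise Poisson identity over t. Sum and integral commute on both sides because
the integrals of the norms are summable: by |rτ+ℓ|⁻² on the left, by the nomes on the right. -/
theorem tsum_heatTerm_row (m α β : ℝ) (τ : ℍ) {r : ℤ} (hr : r ≠ 0) :
    ∑' ℓ : ℤ, heatTerm (m ^ 2 * τ.im) α β τ (r, ℓ) = ∑' n : ℤ, dualTerm α β m τ r n := by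
  have hτ := τ.im_pos
  have hr' : (r : ℝ) ≠ 0 := by exact_mod_cast hr
  set μ := m ^ 2 * τ.im with hμdef
  have hμ : 0 ≤ μ := by positivity
  have hA : ∀ ℓ : ℤ, 0 < ‖latticePoint τ (r, ℓ)‖ ^ 2 / τ.im := fun ℓ => by
    have : 0 < ‖latticePoint τ (r, ℓ)‖ :=
      norm_pos_iff.mpr (latticePoint_ne_zero τ fun h => hr (congrArg Prod.fst h))
    positivity
  have hF := hasSum_integral_of_summable_integral_norm
    (μ := volume.restrict (Set.Ioi (0 : ℝ)))
    (F := fun (ℓ : ℤ) (t : ℝ) => phase (r * β - ℓ * α) *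
        (Real.exp (-Real.pi * μ / t - Real.pi * (‖latticePoint τ (r, ℓ)‖ ^ 2 / τ.im) * t) : ℝ))
    (fun ℓ => integrableOn_heat_ofReal hμ (hA ℓ) _)
    (by simpa only [integral_norm_heat_ofReal _ _ (norm_phase _)]
          using summable_heatIntegral_row hμ τ hr)
  simp only [integral_heat_ofReal] at hF
  have hCpos : 0 < Real.pi * r ^ 2 * τ.im := by positivity
  have hBpos : ∀ n : ℤ, 0 ≤ Real.pi * (τ.im * (n + α) ^ 2 + μ) := fun n => by positivity
  have hval : ∀ n : ℤ, √τ.im * ∫ t in Set.Ioi (0 : ℝ), (√t)⁻¹ *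
      Real.exp (-(Real.pi * (τ.im * (n + α) ^ 2 + μ)) / t - Real.pi * r ^ 2 * τ.im * t) =
      |(r : ℝ)|⁻¹ *
        Real.exp (-2 * Real.pi * τ.im * (|(r : ℝ)| * √(m ^ 2 + (n + α) ^ 2))) := by
    intro n
    rw [integral_inv_sqrt_mul_exp hCpos (hBpos n), ← mul_assoc, ← Real.sqrt_mul hτ.le]
    have h1 : τ.im * (Real.pi / (Real.pi * r ^ 2 * τ.im)) = ((r : ℝ) ^ 2)⁻¹ := by
      have := Real.pi_ne_zero
      field_simp
    have h2 : Real.pi * r ^ 2 * τ.im * (Real.pi * (τ.im * (n + α) ^ 2 + μ)) =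
        (Real.pi * τ.im * |(r : ℝ)|) ^ 2 * (m ^ 2 + (n + α) ^ 2) := by
      rw [mul_pow, sq_abs, hμdef]
      ring
    rw [h1, Real.sqrt_inv, Real.sqrt_sq_eq_abs, h2, Real.sqrt_mul (by positivity),
      Real.sqrt_sq (by positivity)]
    ring_nf
  have hG := hasSum_integral_of_summable_integral_norm
    (μ := volume.restrict (Set.Ioi (0 : ℝ)))
    (F := fun (n : ℤ) (t : ℝ) => (√τ.im : ℂ) * phase (r * ((n + α) * τ.re + β)) *
        (((√t)⁻¹ * Real.exp (-(Real.pi * (τ.im * (n + α) ^ 2 + μ)) / t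
          - Real.pi * r ^ 2 * τ.im * t) : ℝ) : ℂ))
    (fun n => ((integrableOn_inv_sqrt_mul_exp hCpos (hBpos n)).ofReal.const_mul _))
    (by
      refine (summable_dualTerm α β m τ hr).norm.congr fun n => ?_
      have : ∀ t : ℝ, ‖(√τ.im : ℂ) * phase (r * ((n + α) * τ.re + β)) *
        (((√t)⁻¹ * Real.exp (-(Real.pi * (τ.im * (n + α) ^ 2 + μ)) / t
          - Real.pi * r ^ 2 * τ.im * t) : ℝ) : ℂ)‖ = √τ.im * ((√t)⁻¹ *
          Real.exp (-(Real.pi * (τ.im * (n + α) ^ 2 + μ)) / t - Real.pi * r ^ 2 * τ.im * t)) := by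
        intro t
        rw [norm_mul, norm_mul, norm_phase, norm_real, norm_real, mul_one,
          Real.norm_of_nonneg (Real.sqrt_nonneg _), Real.norm_of_nonneg (by positivity)]
      simp_rw [this]
      rw [integral_const_mul, hval n, dualTerm, norm_mul, norm_phase, norm_real, mul_one,
        Real.norm_of_nonneg (by positivity)])
  have hint : ∀ n : ℤ, (∫ t in Set.Ioi (0 : ℝ), (√τ.im : ℂ) * phase (r * ((n + α) * τ.re + β)) *
        (((√t)⁻¹ * Real.exp (-(Real.pi * (τ.im * (n + α) ^ 2 + μ)) / t
          - Real.pi * r ^ 2 * τ.im * t) : ℝ) : ℂ)) = dualTerm α β m τ r n := by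
    intro n
    rw [integral_const_mul, integral_complex_ofReal, dualTerm, ← hval n]
    push_cast
    ring
  simp only [hint] at hG
  refine hF.tsum_eq.trans (Eq.trans ?_ hG.tsum_eq.symm)
  exact setIntegral_congr_fun measurableSet_Ioi fun t ht => heat_row_eq ht r μ α β

/-! ### The partition function as a squared modulus -/

/-- The product `∏ₙ (1 - nome n)` over half of the factors of the partition function. -/
noncomputable def halfProduct (α β m : ℝ) (τ : ℍ) : ℂ := ∏' n : ℤ, (1 + -nome α β m τ n)

theorem multipliable_one_sub_nome (α β m : ℝ) (τ : ℍ) :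
    Multipliable fun n : ℤ => 1 + -nome α β m τ n :=
  multipliable_one_add_of_summable (by simpa using summable_norm_nome α β m τ)

theorem fermionFactor_one (α β m : ℝ) (τ : ℍ) (n : ℤ) :
    fermionFactor α β m τ n 1 = 1 + -nome α β m τ n := by
  rw [fermionFactor, nome, phase, ofReal_exp, ← Complex.exp_add, sub_eq_add_neg]
  congr 3
  push_cast
  ring_nf

/-- Since n - α = -(-n + α), the square root is unchanged under n ↦ -n and the phase is inverted. -/
theorem fermionFactor_neg_one (α β m : ℝ) (τ : ℍ) (n : ℤ) :
    fermionFactor α β m τ n (-1) = conj (1 + -nome α β m τ (-n)) := by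
  have h : ((n : ℝ) + -1 * α) ^ 2 = (((-n : ℤ) : ℝ) + α) ^ 2 := by push_cast; ring
  rw [fermionFactor, nome, map_add, map_one, map_neg, map_mul, conj_ofReal, conj_phase, phase,
    ofReal_exp, ← Complex.exp_add, sub_eq_add_neg, h]
  congr 3
  push_cast
  ring_nf

theorem hasProd_fermionFactorPair (α β m : ℝ) (τ : ℍ) :
    HasProd (fermionFactorPair α β m τ)
      (halfProduct α β m τ * conj (halfProduct α β m τ)) := by
  have h := (multipliable_one_sub_nome α β m τ).hasProd
  have h2 := ((Equiv.neg ℤ).hasProd_iff.mpr h).map (starRingEnd ℂ) continuous_conj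
  refine (h.mul h2).congr_fun ?_
  intro n
  rw [fermionFactorPair, fermionFactor_one, fermionFactor_neg_one]
  rfl

theorem partitionFunction_eq (α β m : ℝ) (τ : ℍ) :
    partitionFunction α β m τ =
      ((Real.exp (-8 * Real.pi * casimir α m * τ.im) * ‖halfProduct α β m τ‖ ^ 2 : ℝ) : ℂ) := by
  rw [partitionFunction, (hasProd_fermionFactorPair α β m τ).tprod_eq, mul_conj, normSq_eq_norm_sq]
  push_cast
  rfl

/-! ### Convergence of the Casimir series and of the lattice sum -/

theorem abs_casimirTerm_le (α m : ℝ) (ℓ : ℕ) :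
    |casimirTerm α m ℓ| ≤ 1 / ((ℓ : ℝ) + 1) ^ 2 := by
  have hπ := Real.pi_pos
  rw [casimirTerm_eq α m ℓ one_pos, abs_mul, abs_of_nonneg (a := _ * heatIntegral _ _)
    (mul_nonneg (by positivity) (heatIntegral_nonneg _ _))]
  have h := heatIntegral_le (μ := m ^ 2 * 1) (A := ((ℓ : ℝ) + 1) ^ 2 / 1) (by positivity)
    (by positivity)
  calc _ ≤ 1 * (Real.pi / 1 * (1 / (Real.pi * (((ℓ : ℝ) + 1) ^ 2 / 1)))) := by
        refine mul_le_mul (Real.abs_cos_le_one _) ?_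
          (mul_nonneg (by positivity) (heatIntegral_nonneg _ _)) zero_le_one
        exact mul_le_mul_of_nonneg_left h (by positivity)
    _ = _ := by field_simp

theorem summable_inv_succ_sq : Summable fun ℓ : ℕ => 1 / ((ℓ : ℝ) + 1) ^ 2 := by
  have := (summable_nat_add_iff 1).mpr (Real.summable_one_div_nat_pow.mpr one_lt_two)
  simpa using this

theorem summable_casimirTerm (α m : ℝ) : Summable (casimirTerm α m) :=
  summable_inv_succ_sq.of_norm_bounded (abs_casimirTerm_le α m)

theorem heatTerm_zero_add (μ α β : ℝ) (τ : ℍ) (ℓ : ℤ) :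
    heatTerm μ α β τ (0, ℓ) + heatTerm μ α β τ (0, -ℓ) =
      ((2 * (Real.cos (2 * Real.pi * ℓ * α) * heatIntegral μ (ℓ ^ 2 / τ.im)) : ℝ) : ℂ) := by
  have h1 : ‖latticePoint τ (0, ℓ)‖ ^ 2 = ℓ ^ 2 := by rw [norm_latticePoint_sq]; simp
  have h2 : ‖latticePoint τ (0, -ℓ)‖ ^ 2 = ℓ ^ 2 := by rw [norm_latticePoint_sq]; simp
  have h3 : phase (ℓ * α) + conj (phase (ℓ * α)) = (2 * Real.cos (2 * Real.pi * ℓ * α) : ℝ) := by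
    rw [add_conj, phase_re]
    ring_nf
  rw [conj_phase] at h3
  simp only [heatTerm, h1, h2]
  rw [← add_mul]
  have h4 : ((0 : ℤ) : ℝ) * β - (ℓ : ℝ) * α = -(ℓ * α) := by simp
  have h5 : ((0 : ℤ) : ℝ) * β - ((-ℓ : ℤ) : ℝ) * α = ℓ * α := by simp
  rw [h4, h5, add_comm, h3]
  push_cast
  ring

theorem summable_norm_latticePoint_rpow (τ : ℍ) {k : ℝ} (hk : 2 < k) :
    Summable fun p : ℤ × ℤ => ‖latticePoint τ p‖ ^ (-k) := by
  have h := ((EisensteinSeries.summable_one_div_norm_rpow hk).mul_left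
    (EisensteinSeries.r τ ^ (-k))).of_nonneg_of_le (fun x => by positivity)
    (fun x => EisensteinSeries.summand_bound τ (by linarith) x)
  rw [← (finTwoArrowEquiv ℤ).symm.summable_iff] at h
  exact h.congr fun p => by simp [latticePoint]

theorem norm_latticePoint_pos (τ : ℍ) (p : LatticeIndex) : 0 < ‖latticePoint τ p.1‖ :=
  norm_pos_iff.mpr (latticePoint_ne_zero τ p.2)

theorem summable_heatIntegral {μ : ℝ} (hμ : 0 < μ) (τ : ℍ) :
    Summable fun p : LatticeIndex => heatIntegral μ (‖latticePoint τ p.1‖ ^ 2 / τ.im) := by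
  have hτ := τ.im_pos
  have h := ((summable_norm_latticePoint_rpow τ (k := 4) (by norm_num)).subtype
    {p : ℤ × ℤ | p ≠ 0}).mul_left (1 / (Real.pi * μ) * (τ.im / Real.pi) ^ 2)
  refine h.of_nonneg_of_le (fun p => heatIntegral_nonneg _ _) fun p => ?_
  have hN := norm_latticePoint_pos τ p
  refine (heatIntegral_le_sq hμ (by positivity)).trans_eq ?_
  simp only [Function.comp]
  rw [Real.rpow_neg hN.le, show (4 : ℝ) = ((4 : ℕ) : ℝ) by norm_num, Real.rpow_natCast]
  have := Real.pi_ne_zero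
  field_simp

theorem summable_heatTerm {μ : ℝ} (hμ : 0 < μ) (α β : ℝ) (τ : ℍ) :
    Summable fun p : LatticeIndex => heatTerm μ α β τ p.1 :=
  (summable_heatIntegral hμ τ).of_norm_bounded fun p => (norm_heatTerm μ α β τ p.1).le

theorem bessel_eq_heatTerm {μ : ℝ} (hμ : 0 < μ) (z : ℂ) (τ : ℍ) (p : LatticeIndex) :
    2 * (√(μ * τ.im) : ℂ) * besselTerm μ z τ p =
      heatTerm μ (coordAlpha z τ) (coordBeta z τ) τ p.1 := by
  rw [heatTerm, ← besselK_one_eq hμ τ.im_pos (norm_latticePoint_pos τ p), besselTerm,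
    latticeChar_eq]
  push_cast
  ring

theorem summable_besselTerm {μ : ℝ} (hμ : 0 < μ) (z : ℂ) (τ : ℍ) :
    Summable (besselTerm μ z τ) := by
  have hτ := τ.im_pos
  have hc : (2 * (√(μ * τ.im) : ℂ)) ≠ 0 := by
    have : √(μ * τ.im) ≠ 0 := (Real.sqrt_pos.mpr (by positivity)).ne'
    exact mul_ne_zero two_ne_zero (by exact_mod_cast this)
  rw [← summable_mul_left_iff hc]
  exact (summable_heatTerm hμ _ _ τ).congr fun p => (bessel_eq_heatTerm hμ z τ p).symm

/-! ### Summation by rows and the logarithm of Z -/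

/-- The row `r` of the lattice sum, with the origin removed. -/
noncomputable def heatRow (μ α β : ℝ) (τ : ℍ) (r : ℤ) : ℂ :=
  ∑' ℓ : ℤ, {p : ℤ × ℤ | p ≠ 0}.indicator (heatTerm μ α β τ) (r, ℓ)

theorem hasSum_heatRow {μ : ℝ} (hμ : 0 < μ) (α β : ℝ) (τ : ℍ) :
    HasSum (heatRow μ α β τ) (∑' p : LatticeIndex, heatTerm μ α β τ p.1) := by
  have hs : Summable ({p : ℤ × ℤ | p ≠ 0}.indicator (heatTerm μ α β τ)) :=
    summable_subtype_iff_indicator.mp (summable_heatTerm hμ α β τ)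
  have h := hs.hasSum
  rw [← tsum_subtype {p : ℤ × ℤ | p ≠ 0} (heatTerm μ α β τ)] at h
  exact h.prod_fiberwise fun r => (hs.prod_factor r).hasSum

theorem heatRow_of_ne_zero (m α β : ℝ) (τ : ℍ) {r : ℤ} (hr : r ≠ 0) :
    heatRow (m ^ 2 * τ.im) α β τ r = ∑' n : ℤ, dualTerm α β m τ r n := by
  rw [← tsum_heatTerm_row m α β τ hr, heatRow]
  refine tsum_congr fun ℓ => Set.indicator_of_mem ?_ _
  exact fun h => hr (congrArg Prod.fst h)

theorem heatRow_zero {m : ℝ} (hm : 0 < m) (α β : ℝ) (τ : ℍ) :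
    heatRow (m ^ 2 * τ.im) α β τ 0 = ((8 * Real.pi * casimir α m * τ.im : ℝ) : ℂ) := by
  have hτ := τ.im_pos
  have hμ : 0 < m ^ 2 * τ.im := by positivity
  have hs : Summable ({p : ℤ × ℤ | p ≠ 0}.indicator (heatTerm (m ^ 2 * τ.im) α β τ)) :=
    summable_subtype_iff_indicator.mp (summable_heatTerm hμ α β τ)
  have h0 := hs.prod_factor 0
  have h1 := h0.comp_injective (i := fun n : ℕ => (n : ℤ) + 1)
    (fun a b h => by simpa using h)
  have h2 := h0.comp_injective (i := fun n : ℕ => -((n : ℤ) + 1))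
    (fun a b h => by simpa using h)
  -- The row splits into ℓ ≥ 1, ℓ ≤ -1 and the origin, which the indicator kills; pairing ±ℓ
  -- produces the cosine.
  have h3 := HasSum.of_add_one_of_neg_add_one (f := fun ℓ : ℤ =>
    {p : ℤ × ℤ | p ≠ 0}.indicator (heatTerm (m ^ 2 * τ.im) α β τ) (0, ℓ)) h1.hasSum h2.hasSum
  have hz : {p : ℤ × ℤ | p ≠ 0}.indicator (heatTerm (m ^ 2 * τ.im) α β τ) (0, 0) = 0 :=
    Set.indicator_of_notMem (by simp) _
  rw [heatRow, h3.tsum_eq, hz, add_zero, ← h1.tsum_add h2]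
  have e : ∀ n : ℕ, ((fun ℓ : ℤ => {p : ℤ × ℤ | p ≠ 0}.indicator
        (heatTerm (m ^ 2 * τ.im) α β τ) (0, ℓ)) ∘ fun n : ℕ => (n : ℤ) + 1) n +
      ((fun ℓ : ℤ => {p : ℤ × ℤ | p ≠ 0}.indicator
        (heatTerm (m ^ 2 * τ.im) α β τ) (0, ℓ)) ∘ fun n : ℕ => -((n : ℤ) + 1)) n =
      ((2 * τ.im / Real.pi * casimirTerm α m n : ℝ) : ℂ) := by
    intro n
    have hn : (n : ℤ) + 1 ≠ 0 := by omega
    simp only [Function.comp]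
    rw [Set.indicator_of_mem (by simpa using hn), Set.indicator_of_mem
      (by simpa [Prod.ext_iff] using (show ¬ (-1 + -(n : ℤ) = 0) by omega)), heatTerm_zero_add,
      casimirTerm_eq α m n hτ]
    congr 1
    have := Real.pi_ne_zero
    push_cast
    field_simp
  rw [tsum_congr e, ← ofReal_tsum, tsum_mul_left, casimir]
  congr 1
  have := Real.pi_ne_zero
  field_simp
  ring

/-- A positive mass keeps all nomes below ρ = exp(-2πτ₂m) < 1, so the double series is dominated by
∑ |qₙ| ρᵏ. -/
theorem summable_nome_pow {m : ℝ} (hm : 0 < m) (α β : ℝ) (τ : ℍ) :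
    Summable fun x : ℤ × ℕ => nome α β m τ x.1 ^ (x.2 + 1) / ((x.2 : ℂ) + 1) := by
  have hτ := τ.im_pos
  set ρ := Real.exp (-2 * Real.pi * τ.im * m) with hρ
  have hρ1 : ρ < 1 := by
    rw [hρ, Real.exp_lt_one_iff]
    have : 0 < 2 * Real.pi * τ.im * m := by positivity
    linarith
  have hρ0 : 0 ≤ ρ := (Real.exp_pos _).le
  have hle : ∀ n, ‖nome α β m τ n‖ ≤ ρ := by
    intro n
    rw [norm_nome, hρ]
    apply Real.exp_le_exp.mpr
    have : m ≤ √(m ^ 2 + (n + α) ^ 2) := Real.le_sqrt_of_sq_le (by nlinarith [sq_nonneg (n + α)])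
    have hp : 0 < 2 * Real.pi * τ.im := by positivity
    nlinarith
  have hs := (summable_norm_nome α β m τ).mul_of_nonneg
    (summable_geometric_of_lt_one hρ0 hρ1) (fun _ => norm_nonneg _) (fun _ => by positivity)
  refine hs.of_norm_bounded fun x => ?_
  have h1 : ‖(x.2 : ℂ) + 1‖ = (x.2 : ℝ) + 1 := by
    rw [← Nat.cast_succ, norm_natCast]
    push_cast
    rfl
  rw [norm_div, norm_pow, h1, pow_succ']
  refine (div_le_self (by positivity) (by linarith [(Nat.cast_nonneg x.2 : (0 : ℝ) ≤ x.2)])).trans ?_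
  exact mul_le_mul_of_nonneg_left (pow_le_pow_left₀ (norm_nonneg _) (hle _) _) (norm_nonneg _)

/-- The double series `∑ₙ ∑_{k ≥ 1} nome n ^ k / k`, which is `-∑ₙ Log (1 - nome n)`. -/
noncomputable def nomeLogSum (α β m : ℝ) (τ : ℍ) : ℂ :=
  ∑' x : ℤ × ℕ, nome α β m τ x.1 ^ (x.2 + 1) / ((x.2 : ℂ) + 1)

theorem halfProduct_eq_exp {m : ℝ} (hm : 0 < m) (α β : ℝ) (τ : ℍ) :
    halfProduct α β m τ = cexp (-nomeLogSum α β m τ) := by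
  have hlog : HasSum (fun n : ℤ => -Complex.log (1 - nome α β m τ n)) (nomeLogSum α β m τ) :=
    HasSum.prod_fiberwise (summable_nome_pow hm α β τ).hasSum
      fun n => by
        have h := hasSum_taylorSeries_neg_log' (norm_nome_lt_one α β hm τ n)
        dsimp only
        exact h
  have e : (cexp ∘ fun n : ℤ => - -Complex.log (1 - nome α β m τ n)) =
      fun n => 1 + -nome α β m τ n := by
    funext n
    have hne : 1 - nome α β m τ n ≠ 0 := by
      intro h
      have h1 := norm_nome_lt_one α β hm τ n
      rw [← sub_eq_zero.mp h, norm_one] at h1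
      exact lt_irrefl _ h1
    simp only [Function.comp, neg_neg]
    rw [Complex.exp_log hne, sub_eq_add_neg]
  have h : HasProd (cexp ∘ fun n : ℤ => - -Complex.log (1 - nome α β m τ n))
      (cexp (-nomeLogSum α β m τ)) := HasSum.cexp hlog.neg
  rw [e] at h
  rw [halfProduct]
  exact h.tprod_eq

/-- The same absolutely convergent double series as for the logarithm of the product, summed first
over n instead of over k. -/
theorem hasSum_heatRow_succ {m : ℝ} (hm : 0 < m) (α β : ℝ) (τ : ℍ) :
    HasSum (fun k : ℕ => heatRow (m ^ 2 * τ.im) α β τ ((k : ℤ) + 1)) (nomeLogSum α β m τ) := by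
  have hsw := ((Equiv.prodComm ℕ ℤ).hasSum_iff.mpr (summable_nome_pow hm α β τ).hasSum)
  refine hsw.prod_fiberwise fun k => ?_
  have hk : (k : ℤ) + 1 ≠ 0 := by omega
  rw [heatRow_of_ne_zero m α β τ hk]
  refine (summable_dualTerm α β m τ hk).hasSum.congr_fun fun n => ?_
  rw [show (k : ℤ) + 1 = ((k + 1 : ℕ) : ℤ) by push_cast; rfl, dualTerm_natCast]
  simp

theorem hasSum_heatRow_neg_succ {m : ℝ} (hm : 0 < m) (α β : ℝ) (τ : ℍ) :
    HasSum (fun k : ℕ => heatRow (m ^ 2 * τ.im) α β τ (-((k : ℤ) + 1)))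
      (conj (nomeLogSum α β m τ)) := by
  refine ((hasSum_heatRow_succ hm α β τ).map (starRingEnd ℂ) continuous_conj).congr_fun
    fun k => ?_
  have hk : (k : ℤ) + 1 ≠ 0 := by omega
  simp only [Function.comp]
  rw [heatRow_of_ne_zero m α β τ hk, heatRow_of_ne_zero m α β τ (neg_ne_zero.mpr hk), conj_tsum]
  exact tsum_congr fun n => dualTerm_neg α β m τ _ n

theorem partitionFunction_eq_exp {m : ℝ} (hm : 0 < m) (α β : ℝ) (τ : ℍ) :
    ∃ S : ℝ, partitionFunction α β m τ = Real.exp (-S) ∧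
      ∑' p : LatticeIndex, heatTerm (m ^ 2 * τ.im) α β τ p.1 = S := by
  have hτ := τ.im_pos
  have hμ : 0 < m ^ 2 * τ.im := by positivity
  have htot := HasSum.of_add_one_of_neg_add_one (hasSum_heatRow_succ hm α β τ)
    (hasSum_heatRow_neg_succ hm α β τ)
  refine ⟨8 * Real.pi * casimir α m * τ.im + 2 * (nomeLogSum α β m τ).re, ?_, ?_⟩
  · rw [partitionFunction_eq, halfProduct_eq_exp hm, Complex.norm_exp, ← Real.exp_nat_mul,
      ← Real.exp_add]
    congr 2
    rw [neg_re]
    push_cast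
    ring
  · rw [(hasSum_heatRow hμ α β τ).unique htot, heatRow_zero hm, add_right_comm, add_conj]
    push_cast
    ring

theorem massOf_sq {μ : ℝ} (hμ : 0 ≤ μ) (τ : ℍ) : massOf μ τ ^ 2 * τ.im = μ := by
  have hτ := τ.im_pos
  rw [massOf, Real.sq_sqrt (by positivity), div_mul_cancel₀ _ hτ.ne']

theorem massOf_pos {μ : ℝ} (hμ : 0 < μ) (τ : ℍ) : 0 < massOf μ τ :=
  Real.sqrt_pos.mpr (div_pos hμ τ.im_pos)

theorem massiveE1_eq_tsum {μ : ℝ} (hμ : 0 < μ) (z : ℂ) (τ : ℍ) :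
    massiveE1 μ z τ =
      ∑' p : LatticeIndex, heatTerm μ (coordAlpha z τ) (coordBeta z τ) τ p.1 := by
  obtain ⟨S, h1, h2⟩ := partitionFunction_eq_exp (massOf_pos hμ τ) (coordAlpha z τ)
    (coordBeta z τ) τ
  rw [massOf_sq hμ.le] at h2
  rw [h2, massiveE1, h1, ← ofReal_log (Real.exp_pos _).le, Real.log_exp]
  simp

theorem massive_wellDefined {μ : ℝ} (hμ : 0 < μ) (α β : ℝ) (τ : ℍ) :
    PartitionFunctionWellDefined α β (massOf μ τ) τ := by
  refine ⟨summable_casimirTerm _ _, (hasProd_fermionFactorPair _ _ _ _).multipliable, ?_⟩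
  obtain ⟨S, h1, -⟩ := partitionFunction_eq_exp (massOf_pos hμ τ) α β τ
  rw [h1]
  exact_mod_cast (Real.exp_pos _).ne'

/-! ### The theta series: convergence and decay at infinity -/

theorem exp_neg_le_factorial_div (k : ℕ) {y : ℝ} (hy : 0 < y) :
    Real.exp (-y) ≤ k.factorial / y ^ k := by
  have h := Real.pow_div_factorial_le_exp y hy.le k
  rw [Real.exp_neg, inv_le_comm₀ (Real.exp_pos _) (by positivity), inv_div]
  exact h

/-- The term of index `p` of the theta series `∑ χ(p) exp(-π t |p|² / τ₂)`. -/
noncomputable def thetaTerm (α β : ℝ) (τ : ℍ) (t : ℝ) (p : ℤ × ℤ) : ℂ :=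
  phase (p.1 * β - p.2 * α) * (Real.exp (-(Real.pi * (‖latticePoint τ p‖ ^ 2 / τ.im)) * t) : ℝ)

/-- The theta series without the contribution of the origin. -/
noncomputable def thetaSeries (α β : ℝ) (τ : ℍ) (t : ℝ) : ℂ :=
  ∑' p : LatticeIndex, thetaTerm α β τ t p.1

theorem norm_thetaTerm (α β : ℝ) (τ : ℍ) (t : ℝ) (p : ℤ × ℤ) :
    ‖thetaTerm α β τ t p‖ = Real.exp (-(Real.pi * (‖latticePoint τ p‖ ^ 2 / τ.im)) * t) := by
  rw [thetaTerm, norm_mul, norm_phase, one_mul, norm_real, Real.norm_of_nonneg (Real.exp_pos _).le]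

theorem norm_thetaTerm_le (α β : ℝ) (τ : ℍ) (k : ℕ) {t : ℝ} (ht : 0 < t) (p : LatticeIndex) :
    ‖thetaTerm α β τ t p.1‖ ≤
      (k.factorial * (τ.im / Real.pi) ^ k * (‖latticePoint τ p.1‖ ^ (2 * k))⁻¹) * (t ^ k)⁻¹ := by
  have hτ := τ.im_pos
  have hN := norm_latticePoint_pos τ p
  have hπ := Real.pi_pos
  rw [norm_thetaTerm, neg_mul]
  refine (exp_neg_le_factorial_div k (by positivity)).trans_eq ?_
  rw [mul_pow, mul_pow, div_pow, div_pow, pow_mul]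
  field_simp

theorem summable_norm_latticePoint_inv_pow (τ : ℍ) {k : ℕ} (hk : 2 < k) :
    Summable fun p : ℤ × ℤ => (‖latticePoint τ p‖ ^ k)⁻¹ := by
  refine (summable_norm_latticePoint_rpow τ (k := k) (by exact_mod_cast hk)).congr fun p => ?_
  rw [Real.rpow_neg (norm_nonneg _), Real.rpow_natCast]

theorem summable_thetaBound (τ : ℍ) {k : ℕ} (hk : 2 ≤ k) :
    Summable fun p : LatticeIndex =>
      k.factorial * (τ.im / Real.pi) ^ k * (‖latticePoint τ p.1‖ ^ (2 * k))⁻¹ :=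
  ((summable_norm_latticePoint_inv_pow τ (k := 2 * k) (by omega)).subtype
    {p : ℤ × ℤ | p ≠ 0}).mul_left _

theorem summable_thetaTerm (α β : ℝ) (τ : ℍ) {t : ℝ} (ht : 0 < t) :
    Summable fun p : LatticeIndex => thetaTerm α β τ t p.1 :=
  ((summable_thetaBound τ le_rfl).mul_right _).of_norm_bounded
    fun p => norm_thetaTerm_le α β τ 2 ht p

theorem norm_thetaSeries_le (α β : ℝ) (τ : ℍ) {k : ℕ} (hk : 2 ≤ k) {t : ℝ} (ht : 0 < t) :
    ‖thetaSeries α β τ t‖ ≤ (∑' p : LatticeIndex,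
      k.factorial * (τ.im / Real.pi) ^ k * (‖latticePoint τ p.1‖ ^ (2 * k))⁻¹) * (t ^ k)⁻¹ :=
  tsum_of_norm_bounded ((summable_thetaBound τ hk).hasSum.mul_right _)
    fun p => norm_thetaTerm_le α β τ k ht p

theorem thetaSeries_isBigO_atTop (α β : ℝ) (τ : ℍ) {k : ℕ} (hk : 2 ≤ k) :
    thetaSeries α β τ =O[atTop] fun t : ℝ => t ^ (-(k : ℝ)) := by
  refine Asymptotics.IsBigO.of_bound (∑' p : LatticeIndex,
      k.factorial * (τ.im / Real.pi) ^ k * (‖latticePoint τ p.1‖ ^ (2 * k))⁻¹) ?_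
  filter_upwards [eventually_gt_atTop 0] with t ht
  rw [Real.rpow_neg ht.le, Real.rpow_natCast, Real.norm_of_nonneg (by positivity)]
  exact norm_thetaSeries_le α β τ hk ht

theorem continuousOn_thetaSeries (α β : ℝ) (τ : ℍ) :
    ContinuousOn (thetaSeries α β τ) (Set.Ioi 0) := by
  have hτ := τ.im_pos
  have hπ := Real.pi_pos
  intro t ht
  have ht : 0 < t := ht
  have hc : ContinuousOn (thetaSeries α β τ) (Set.Ioi (t / 2)) := by
    refine continuousOn_tsum (u := fun p : LatticeIndex => ‖thetaTerm α β τ (t / 2) p.1‖)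
      (fun p => ?_) (summable_thetaTerm α β τ (half_pos ht)).norm ?_
    · unfold thetaTerm
      fun_prop
    · intro p x hx
      rw [norm_thetaTerm, norm_thetaTerm]
      apply Real.exp_le_exp.mpr
      have hx : t / 2 < x := hx
      have h1 : 0 ≤ Real.pi * (‖latticePoint τ p.1‖ ^ 2 / τ.im) := by positivity
      nlinarith
  exact (hc.continuousAt (Ioi_mem_nhds (half_lt_self ht))).continuousWithinAt

/-! ### The theta series near zero -/

theorem summable_norm_latticePoint_add (τ : ℍ) (z : ℂ) :
    Summable fun p : ℤ × ℤ => (‖latticePoint τ p + z‖ ^ 4)⁻¹ := by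
  have hs := summable_norm_latticePoint_inv_pow τ (k := 4) (by norm_num)
  -- 16 = 2⁴: outside a finite set |p| > 2|z| + 1, hence |p + z| ≥ |p|/2.
  refine (hs.mul_left 16).of_norm_bounded_eventually ?_
  have hR : 0 < 2 * ‖z‖ + 1 := by positivity
  have h1 : ∀ᶠ p in cofinite, (‖latticePoint τ p‖ ^ 4)⁻¹ < ((2 * ‖z‖ + 1) ^ 4)⁻¹ :=
    hs.tendsto_cofinite_zero.eventually (gt_mem_nhds (by positivity))
  have h2 : ∀ᶠ p : ℤ × ℤ in cofinite, p ≠ 0 := by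
    simp [Filter.eventually_cofinite]
  filter_upwards [h1, h2] with p hp1 hp2
  have hN : 0 < ‖latticePoint τ p‖ := norm_pos_iff.mpr (latticePoint_ne_zero τ hp2)
  have hlt : 2 * ‖z‖ + 1 < ‖latticePoint τ p‖ := by
    rw [inv_lt_inv₀ (by positivity) (by positivity)] at hp1
    exact lt_of_pow_lt_pow_left₀ 4 hN.le hp1
  have hge : ‖latticePoint τ p‖ / 2 ≤ ‖latticePoint τ p + z‖ := by
    have := norm_sub_le (latticePoint τ p + z) z
    rw [add_sub_cancel_right] at this
    linarith
  rw [Real.norm_of_nonneg (by positivity)]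
  calc (‖latticePoint τ p + z‖ ^ 4)⁻¹ ≤ ((‖latticePoint τ p‖ / 2) ^ 4)⁻¹ :=
        inv_anti₀ (by positivity) (pow_le_pow_left₀ (by positivity) hge 4)
    _ = 16 * (‖latticePoint τ p‖ ^ 4)⁻¹ := by
        rw [div_pow, inv_div]
        ring

theorem hasSum_thetaTerm (α β : ℝ) (τ : ℍ) {t : ℝ} (ht : 0 < t) :
    HasSum (thetaTerm α β τ t) (thetaSeries α β τ t + 1) := by
  have h1 : HasSum ({p : ℤ × ℤ | p ≠ 0}.indicator (thetaTerm α β τ t)) (thetaSeries α β τ t) :=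
    hasSum_subtype_iff_indicator.mp (summable_thetaTerm α β τ ht).hasSum
  refine (h1.add (hasSum_ite_eq (0 : ℤ × ℤ) (1 : ℂ))).congr_fun fun p => ?_
  by_cases hp : p = 0
  · subst hp
    simp [thetaTerm, latticePoint]
  · rw [Set.indicator_of_mem (by exact hp), if_neg hp, add_zero]

theorem norm_latticePoint_add_sq (z : ℂ) (τ : ℍ) (n k : ℤ) :
    ‖latticePoint τ (n, -k) + z‖ ^ 2 =
      (k - ((n + coordAlpha z τ) * τ.re + coordBeta z τ)) ^ 2 +
        τ.im ^ 2 * (n + coordAlpha z τ) ^ 2 := by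
  have hτ := τ.im_ne_zero
  rw [Complex.sq_norm, normSq_apply]
  simp [latticePoint, coordBeta, coordAlpha]
  field_simp
  ring

/-- Two powers of t/Q absorb the factor t⁻¹ and give Q⁻², which for Q proportional to |p+z|² is
summable over the lattice. -/
theorem inv_mul_exp_le {Q t : ℝ} (hQ : 0 < Q) (ht : 0 < t) (ht1 : t ≤ 1) :
    t⁻¹ * Real.exp (-(Q / t)) ≤ 2 / Q ^ 2 := by
  have h := exp_neg_le_factorial_div 2 (y := Q / t) (by positivity)
  calc t⁻¹ * Real.exp (-(Q / t)) ≤ t⁻¹ * ((2 : ℕ).factorial / (Q / t) ^ 2) :=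
        mul_le_mul_of_nonneg_left h (by positivity)
    _ = 2 / Q ^ 2 * t := by
        rw [Nat.factorial_two, div_pow]
        push_cast
        field_simp
    _ ≤ 2 / Q ^ 2 * 1 := mul_le_mul_of_nonneg_left ht1 (by positivity)
    _ = _ := mul_one _

/-- The theta transformation, as two one-variable Poisson summations: in ℓ for each r, then in r for
each n. The added 1 is the origin term, without which Poisson does not apply. -/
theorem thetaSeries_add_one (α β : ℝ) (τ : ℍ) {t : ℝ} (ht : 0 < t) :
    thetaSeries α β τ t + 1 = ∑' n : ℤ, ∑' k : ℤ,
      ((t⁻¹ * Real.exp (-(Real.pi / τ.im *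
        ((k - ((n + α) * τ.re + β)) ^ 2 + τ.im ^ 2 * (n + α) ^ 2) / t)) : ℝ) : ℂ) := by
  have hτ := τ.im_pos
  have hsum := hasSum_thetaTerm α β τ ht
  set G : ℤ → ℤ → ℂ := fun r n => (√τ.im : ℂ) * phase (r * ((n + α) * τ.re + β)) *
        (((√t)⁻¹ * Real.exp (-(Real.pi * (τ.im * (n + α) ^ 2 + 0)) / t
          - Real.pi * r ^ 2 * τ.im * t) : ℝ) : ℂ) with hG
  have hrow : ∀ r : ℤ, ∑' ℓ : ℤ, thetaTerm α β τ t (r, ℓ) = ∑' n : ℤ, G r n := by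
    intro r
    rw [hG, ← heat_row_eq ht r 0 α β]
    refine tsum_congr fun ℓ => ?_
    rw [thetaTerm]
    congr 3
    ring
  -- Up to a constant, |G| is a product of Gaussians in r and in n; this justifies exchanging the
  -- two sums between the Poisson steps.
  have hGs : Summable (Function.uncurry G) := by
    have h1 := summable_gaussian (c := τ.im * t) (by positivity) 0
    have h2 := summable_gaussian (c := τ.im / t) (by positivity) α
    refine ((h1.mul_of_nonneg h2 (fun _ => (Real.exp_pos _).le)
      (fun _ => (Real.exp_pos _).le)).mul_left (√τ.im * (√t)⁻¹)).of_norm_bounded fun x => ?_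
    rw [Function.uncurry_def]
    simp only [hG]
    rw [norm_mul, norm_mul, norm_phase, norm_real, norm_real, mul_one,
      Real.norm_of_nonneg (Real.sqrt_nonneg _), Real.norm_of_nonneg (by positivity),
      ← Real.exp_add, ← mul_assoc]
    refine le_of_eq ?_
    congr 2
    field_simp
    ring
  rw [← hsum.tsum_eq, hsum.summable.tsum_prod, tsum_congr hrow, ← hGs.tsum_comm]
  refine tsum_congr fun n => ?_
  set w := (n + α) * τ.re + β with hw
  have hP := gaussian_poisson (c := t * τ.im) (by positivity) 0 (-w)
  have e1 : ∀ r : ℤ, G r n = ((√τ.im * (√t)⁻¹ *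
      Real.exp (-(Real.pi / τ.im * (τ.im ^ 2 * (n + α) ^ 2) / t)) : ℝ) : ℂ) *
      ((Real.exp (-Real.pi * (t * τ.im) * (r + 0) ^ 2) : ℂ) * phase (-(r * -w))) := by
    intro r
    have h1 : -(Real.pi * (τ.im * (n + α) ^ 2 + 0)) / t - Real.pi * r ^ 2 * τ.im * t =
        -(Real.pi / τ.im * (τ.im ^ 2 * (n + α) ^ 2) / t) +
          -Real.pi * (t * τ.im) * (r + 0) ^ 2 := by
      field_simp
      ring
    simp only [hG]
    rw [← hw, h1, Real.exp_add, show -((r : ℝ) * -w) = r * w by ring]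
    push_cast
    ring
  rw [tsum_congr e1, tsum_mul_left, hP, ← tsum_mul_left, ← tsum_mul_left]
  refine tsum_congr fun k => ?_
  have h2 : Real.pi / τ.im * ((k - w) ^ 2 + τ.im ^ 2 * (n + α) ^ 2) / t =
      Real.pi / τ.im * (τ.im ^ 2 * (n + α) ^ 2) / t + Real.pi / (t * τ.im) * (k - w) ^ 2 := by
    field_simp
    ring
  rw [h2, neg_add (Real.pi / τ.im * (τ.im ^ 2 * (n + α) ^ 2) / t), Real.exp_add, zero_mul, phase_zero, mul_one, Real.sqrt_mul ht.le]
  have h3 : t⁻¹ = √τ.im * (√t)⁻¹ * (√t * √τ.im)⁻¹ := by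
    have h4 : √τ.im ≠ 0 := (Real.sqrt_pos.mpr hτ).ne'
    have h5 : √t ≠ 0 := (Real.sqrt_pos.mpr ht).ne'
    have h6 := Real.mul_self_sqrt ht.le
    field_simp
    nlinarith
  rw [h3, show -(Real.pi / (t * τ.im) * (k - w) ^ 2) = -Real.pi / (t * τ.im) * (k + -w) ^ 2 by ring]
  push_cast
  ring

/-- As z is off the lattice, no dual exponent vanishes, so no term grows like t⁻¹ and each is
bounded by a multiple of |p+z|⁻⁴. -/
theorem thetaSeries_bounded (z : ℂ) (τ : ℍ) (hz : ∀ p : ℤ × ℤ, latticePoint τ p + z ≠ 0) :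
    ∃ C : ℝ, ∀ t : ℝ, 0 < t → t ≤ 1 →
      ‖thetaSeries (coordAlpha z τ) (coordBeta z τ) τ t‖ ≤ C := by
  have hτ := τ.im_pos
  have hπ := Real.pi_pos
  have hs : Summable fun x : ℤ × ℤ =>
      2 * (τ.im / Real.pi) ^ 2 * (‖latticePoint τ (x.1, -x.2) + z‖ ^ 4)⁻¹ :=
    (((Equiv.prodCongr (Equiv.refl ℤ) (Equiv.neg ℤ)).summable_iff.mpr
      (summable_norm_latticePoint_add τ z)).mul_left _)
  refine ⟨(∑' x : ℤ × ℤ, 2 * (τ.im / Real.pi) ^ 2 * (‖latticePoint τ (x.1, -x.2) + z‖ ^ 4)⁻¹) + 1,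
    fun t ht ht1 => ?_⟩
  have hb : ‖thetaSeries (coordAlpha z τ) (coordBeta z τ) τ t + 1‖ ≤
      ∑' x : ℤ × ℤ, 2 * (τ.im / Real.pi) ^ 2 * (‖latticePoint τ (x.1, -x.2) + z‖ ^ 4)⁻¹ := by
    rw [thetaSeries_add_one _ _ τ ht]
    refine tsum_of_norm_bounded (hs.hasSum.prod_fiberwise fun n => (hs.prod_factor n).hasSum)
      fun n => ?_
    refine tsum_of_norm_bounded (hs.prod_factor n).hasSum fun k => ?_
    have hN : 0 < ‖latticePoint τ (n, -k) + z‖ := norm_pos_iff.mpr (hz _)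
    rw [← norm_latticePoint_add_sq, norm_real, Real.norm_of_nonneg (by positivity)]
    refine (inv_mul_exp_le (by positivity) ht ht1).trans_eq ?_
    field_simp
  have h1 := norm_sub_le (thetaSeries (coordAlpha z τ) (coordBeta z τ) τ t + 1) 1
  rw [add_sub_cancel_right, norm_one] at h1
  linarith

/-! ### The Mellin transform and the Kronecker–Eisenstein series -/

theorem thetaSeries_isBigO_zero (z : ℂ) (τ : ℍ) (hz : ∀ p : ℤ × ℤ, latticePoint τ p + z ≠ 0) :
    thetaSeries (coordAlpha z τ) (coordBeta z τ) τ =O[𝓝[>] 0] fun t : ℝ => t ^ (-(0 : ℝ)) := by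
  obtain ⟨C, hC⟩ := thetaSeries_bounded z τ hz
  refine Asymptotics.IsBigO.of_bound C ?_
  filter_upwards [Ioc_mem_nhdsGT one_pos] with t ht
  simpa using hC t ht.1 ht.2

theorem locallyIntegrableOn_thetaSeries (α β : ℝ) (τ : ℍ) :
    LocallyIntegrableOn (thetaSeries α β τ) (Set.Ioi 0) :=
  (continuousOn_thetaSeries α β τ).locallyIntegrableOn measurableSet_Ioi

theorem isKroneckerEisenstein_mellin (z : ℂ) (τ : ℍ)
    (hz : ∀ p : ℤ × ℤ, latticePoint τ p + z ≠ 0) :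
    IsKroneckerEisenstein z τ (mellin (thetaSeries (coordAlpha z τ) (coordBeta z τ) τ)) := by
  have hτ := τ.im_pos
  have hπ := Real.pi_pos
  constructor
  · refine DifferentiableOn.analyticOnNhd (fun s hs => ?_)
      (isOpen_lt continuous_const Complex.continuous_re)
    -- The decay exponent is chosen after s; the lower end of the strip is 0 because the theta
    -- series is O(1) there.
    obtain ⟨k, hk⟩ := exists_nat_gt (max s.re 2)
    have hk2 : 2 ≤ k := by
      have : (2 : ℝ) < k := lt_of_le_of_lt (le_max_right _ _) hk
      exact_mod_cast this.le
    exact (mellin_differentiableAt_of_isBigO_rpow (locallyIntegrableOn_thetaSeries _ _ τ)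
      (thetaSeries_isBigO_atTop _ _ τ hk2) (lt_of_le_of_lt (le_max_left _ _) hk)
      (thetaSeries_isBigO_zero z τ hz) hs).differentiableWithinAt
  · intro s hs
    have hA : ∀ p : LatticeIndex, 0 < Real.pi * (‖latticePoint τ p.1‖ ^ 2 / τ.im) := fun p => by
      have := norm_latticePoint_pos τ p
      positivity
    have h := hasSum_mellin (ι := LatticeIndex) (s := s)
      (a := fun p => phase (p.1.1 * coordBeta z τ - p.1.2 * coordAlpha z τ))
      (p := fun p => Real.pi * (‖latticePoint τ p.1‖ ^ 2 / τ.im))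
      (F := thetaSeries (coordAlpha z τ) (coordBeta z τ) τ)
      (fun p => Or.inr (hA p)) (by linarith)
      (fun t ht => (summable_thetaTerm _ _ τ ht).hasSum) (by
        have h1 := ((summable_norm_latticePoint_rpow τ (k := 2 * s.re) (by linarith)).subtype
          {p : ℤ × ℤ | p ≠ 0}).mul_left ((Real.pi / τ.im) ^ (-s.re))
        refine h1.congr fun p => ?_
        have hN := norm_latticePoint_pos τ p
        simp only [Function.comp, norm_phase]
        rw [show Real.pi * (‖latticePoint τ p.1‖ ^ 2 / τ.im) =
          Real.pi / τ.im * ‖latticePoint τ p.1‖ ^ 2 by ring,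
          Real.mul_rpow (by positivity) (by positivity), ← Real.rpow_natCast, ← Real.rpow_mul hN.le,
          Real.rpow_neg hN.le, Real.rpow_neg (by positivity), one_div, mul_inv]
        norm_num)
    refine h.congr_fun fun p => ?_
    have hN := norm_latticePoint_pos τ p
    have hc : ((τ.im / Real.pi : ℝ) : ℂ) ^ s ≠ 0 := by
      rw [Ne, cpow_eq_zero_iff, not_and_or]
      exact Or.inl (ofReal_ne_zero.mpr (by positivity))
    have e1 : ((Real.pi * (‖latticePoint τ p.1‖ ^ 2 / τ.im) : ℝ) : ℂ) ^ s =
        (((τ.im / Real.pi : ℝ) : ℂ) ^ s)⁻¹ * (‖latticePoint τ p.1‖ : ℂ) ^ (2 * s) := by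
      rw [show Real.pi * (‖latticePoint τ p.1‖ ^ 2 / τ.im) =
        (τ.im / Real.pi)⁻¹ * ‖latticePoint τ p.1‖ ^ 2 by field_simp, ofReal_mul,
        mul_cpow_ofReal_nonneg (by positivity) (by positivity), ofReal_inv,
        inv_cpow _ _ (by rw [arg_ofReal_of_nonneg (by positivity)]; exact hπ.ne)]
      congr 1
      rw [ofReal_pow, ← Complex.cpow_nat_mul' (n := 2)]
      · norm_num
      · rw [arg_ofReal_of_nonneg hN.le]; linarith
      · rw [arg_ofReal_of_nonneg hN.le]; linarith
    rw [kroneckerEisensteinTerm, e1, latticeChar_eq]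
    field_simp

theorem integrableOn_thetaSeries (z : ℂ) (τ : ℍ)
    (hz : ∀ p : ℤ × ℤ, latticePoint τ p + z ≠ 0) :
    IntegrableOn (thetaSeries (coordAlpha z τ) (coordBeta z τ) τ) (Set.Ioi 0) := by
  have h := mellinConvergent_of_isBigO_rpow (s := 1) (locallyIntegrableOn_thetaSeries _ _ τ)
    (thetaSeries_isBigO_atTop _ _ τ (le_refl 2)) (by norm_num)
    (thetaSeries_isBigO_zero z τ hz) (by norm_num)
  simpa [MellinConvergent] using h

/-! ### The limit of the amplitude as μ → 0 -/

theorem massiveE1_eq_integral {μ : ℝ} (hμ : 0 < μ) (z : ℂ) (τ : ℍ) :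
    massiveE1 μ z τ = ∫ t in Set.Ioi (0 : ℝ), (Real.exp (-Real.pi * μ / t) : ℂ) *
      thetaSeries (coordAlpha z τ) (coordBeta z τ) τ t := by
  have hτ := τ.im_pos
  set α := coordAlpha z τ
  set β := coordBeta z τ
  have h := hasSum_integral_of_summable_integral_norm
    (μ := volume.restrict (Set.Ioi (0 : ℝ)))
    (F := fun (p : LatticeIndex) (t : ℝ) => phase (p.1.1 * β - p.1.2 * α) *
        (Real.exp (-Real.pi * μ / t - Real.pi * (‖latticePoint τ p.1‖ ^ 2 / τ.im) * t) : ℝ))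
    (fun p => integrableOn_heat_ofReal hμ.le
      (by have := norm_latticePoint_pos τ p; positivity) _)
    (by simpa only [integral_norm_heat_ofReal _ _ (norm_phase _)] using summable_heatIntegral hμ τ)
  simp only [integral_heat_ofReal] at h
  rw [massiveE1_eq_tsum hμ]
  refine h.tsum_eq.trans (integral_congr_ae (Eventually.of_forall fun t => ?_))
  dsimp only
  rw [thetaSeries, ← tsum_mul_left]
  refine tsum_congr fun p => ?_
  rw [thetaTerm, sub_eq_add_neg (-Real.pi * μ / t), Real.exp_add, ← neg_mul (Real.pi * _) t]
  push_cast
  ring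

/-- The mass enters only through exp(-πμ/t) ≤ 1, so the integrable theta series dominates. -/
theorem tendsto_massiveE1 (z : ℂ) (τ : ℍ) (hz : ∀ p : ℤ × ℤ, latticePoint τ p + z ≠ 0) :
    Tendsto (fun μ : ℝ => massiveE1 μ z τ) (𝓝[>] 0)
      (𝓝 (mellin (thetaSeries (coordAlpha z τ) (coordBeta z τ) τ) 1)) := by
  set K := thetaSeries (coordAlpha z τ) (coordBeta z τ) τ with hK
  have hint : IntegrableOn K (Set.Ioi 0) := integrableOn_thetaSeries z τ hz
  have hval : mellin K 1 = ∫ t in Set.Ioi (0 : ℝ), K t := by simp [mellin]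
  rw [hval]
  have h : Tendsto (fun μ : ℝ => ∫ t in Set.Ioi (0 : ℝ), (Real.exp (-Real.pi * μ / t) : ℂ) * K t)
      (𝓝[>] 0) (𝓝 (∫ t in Set.Ioi (0 : ℝ), K t)) := by
    refine tendsto_integral_filter_of_dominated_convergence (fun t => ‖K t‖)
      (Eventually.of_forall fun μ => ?_) ?_ hint.norm (Eventually.of_forall fun t => ?_)
    · refine AEStronglyMeasurable.mul ?_ hint.aestronglyMeasurable
      have : Measurable fun t : ℝ => (Real.exp (-Real.pi * μ / t) : ℂ) := by fun_prop
      exact this.aestronglyMeasurable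
    · filter_upwards [self_mem_nhdsWithin] with μ hμ
      filter_upwards [ae_restrict_mem measurableSet_Ioi] with t ht
      have hμ : 0 < μ := hμ
      have ht : 0 < t := ht
      rw [norm_mul, norm_real, Real.norm_of_nonneg (Real.exp_pos _).le]
      refine mul_le_of_le_one_left (norm_nonneg _) (Real.exp_le_one_iff.mpr ?_)
      have : 0 ≤ Real.pi * μ / t := by positivity
      rw [neg_mul, neg_div]
      linarith
    · have hc : Continuous fun μ : ℝ => (Real.exp (-Real.pi * μ / t) : ℂ) * K t := by fun_prop
      have := (hc.tendsto 0).mono_left (nhdsWithin_le_nhds (s := Set.Ioi 0))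
      simpa using this
  refine h.congr' ?_
  filter_upwards [self_mem_nhdsWithin] with μ hμ
  exact (massiveE1_eq_integral hμ z τ).symm

/-! ### The massless partition function -/

theorem massOf_zero (τ : ℍ) : massOf 0 τ = 0 := by simp [massOf]

theorem tendsto_massOf (τ : ℍ) : Tendsto (fun μ => massOf μ τ) (𝓝[>] 0) (𝓝 0) := by
  have hc : Continuous fun μ => massOf μ τ := by
    unfold massOf
    fun_prop
  simpa only [massOf_zero] using (hc.tendsto 0).mono_left nhdsWithin_le_nhds

theorem tendsto_casimir (α : ℝ) (τ : ℍ) :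
    Tendsto (fun μ => casimir α (massOf μ τ)) (𝓝[>] 0) (𝓝 (casimir α 0)) := by
  have hτ := τ.im_pos
  refine Tendsto.const_mul _ (tendsto_tsum_of_dominated_convergence summable_inv_succ_sq
    (fun ℓ => ?_) (Eventually.of_forall fun μ ℓ => abs_casimirTerm_le α _ ℓ))
  have h := ((tendsto_heatIntegral (A := ((ℓ : ℝ) + 1) ^ 2 / τ.im) (by positivity)).const_mul
    (Real.pi / τ.im)).const_mul (Real.cos (2 * Real.pi * ((ℓ : ℝ) + 1) * α))
  have h0 : casimirTerm α 0 ℓ = Real.cos (2 * Real.pi * ((ℓ : ℝ) + 1) * α) *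
      (Real.pi / τ.im * heatIntegral 0 (((ℓ : ℝ) + 1) ^ 2 / τ.im)) := by
    rw [casimirTerm_eq α 0 ℓ hτ]
    simp
  rw [h0]
  refine h.congr' ?_
  filter_upwards [self_mem_nhdsWithin] with μ hμ
  rw [casimirTerm_eq α _ ℓ hτ, massOf_sq (le_of_lt hμ)]

theorem tendsto_halfProduct (α β : ℝ) (τ : ℍ) :
    Tendsto (fun μ => halfProduct α β (massOf μ τ) τ) (𝓝[>] 0) (𝓝 (halfProduct α β 0 τ)) := by
  refine tendsto_tprod_one_add_of_dominated_convergence (summable_nome_bound α τ) (fun n => ?_)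
    (Eventually.of_forall fun μ n => by simpa using norm_nome_le α β (massOf μ τ) τ n)
  have hc : Continuous fun m : ℝ => -nome α β m τ n := by
    unfold nome
    fun_prop
  exact (hc.tendsto 0).comp (tendsto_massOf τ)

theorem tendsto_partitionFunction (α β : ℝ) (τ : ℍ) :
    Tendsto (fun μ => partitionFunction α β (massOf μ τ) τ) (𝓝[>] 0)
      (𝓝 (partitionFunction α β 0 τ)) := by
  simp only [partitionFunction_eq]
  refine (continuous_ofReal.tendsto _).comp (Tendsto.mul ?_ ((tendsto_halfProduct α β τ).norm.pow 2))
  exact (Real.continuous_exp.tendsto _).comp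
    (((tendsto_casimir α τ).const_mul (-8 * Real.pi)).mul_const τ.im)

/-- A vanishing factor needs a nome equal to 1. Its modulus forces n + α = 0 and its phase then
forces β = k ∈ ℤ, so z = -nτ + k would be a lattice point. -/
theorem halfProduct_zero_ne_zero (z : ℂ) (τ : ℍ) (hz : ∀ p : ℤ × ℤ, latticePoint τ p + z ≠ 0) :
    halfProduct (coordAlpha z τ) (coordBeta z τ) 0 τ ≠ 0 := by
  have hτ := τ.im_pos
  have hπ := Real.pi_pos
  refine tprod_one_add_ne_zero_of_summable (fun n hn => ?_)
    (by simpa using summable_norm_nome (coordAlpha z τ) (coordBeta z τ) 0 τ)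
  have h1 : nome (coordAlpha z τ) (coordBeta z τ) 0 τ n = 1 := by
    linear_combination -hn
  have h2 : (n : ℝ) + coordAlpha z τ = 0 := by
    have h3 := norm_nome (coordAlpha z τ) (coordBeta z τ) 0 τ n
    rw [h1, norm_one, eq_comm, Real.exp_eq_one_iff] at h3
    have h4 : √(0 ^ 2 + ((n : ℝ) + coordAlpha z τ) ^ 2) = 0 := by
      have : (-2 * Real.pi * τ.im) ≠ 0 := by
        have : 0 < 2 * Real.pi * τ.im := by positivity
        linarith
      exact (mul_eq_zero.mp h3).resolve_left this
    rw [zero_pow two_ne_zero, zero_add, Real.sqrt_sq_eq_abs] at h4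
    exact abs_eq_zero.mp h4
  rw [nome, h2] at h1
  simp only [zero_pow two_ne_zero, add_zero, Real.sqrt_zero, mul_zero, Real.exp_zero, zero_mul,
    zero_add, ofReal_one, one_mul] at h1
  obtain ⟨k, hk⟩ := (phase_eq_one_iff _).mp h1
  apply hz (n, -k)
  have h5 := norm_latticePoint_add_sq z τ n k
  rw [h2, hk] at h5
  simpa using h5

theorem partitionFunction_zero_pos (z : ℂ) (τ : ℍ)
    (hz : ∀ p : ℤ × ℤ, latticePoint τ p + z ≠ 0) :
    ∃ x : ℝ, 0 < x ∧ partitionFunction (coordAlpha z τ) (coordBeta z τ) 0 τ = x := by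
  refine ⟨_, ?_, partitionFunction_eq _ _ _ τ⟩
  have := norm_pos_iff.mpr (halfProduct_zero_ne_zero z τ hz)
  positivity

/-- The massless value of Z is a positive real, where the principal logarithm is continuous. -/
theorem tendsto_massiveE1_zero (z : ℂ) (τ : ℍ) (hz : ∀ p : ℤ × ℤ, latticePoint τ p + z ≠ 0) :
    Tendsto (fun μ : ℝ => massiveE1 μ z τ) (𝓝[>] 0) (𝓝 (massiveE1 0 z τ)) := by
  obtain ⟨x, hx, hZ⟩ := partitionFunction_zero_pos z τ hz
  unfold massiveE1
  rw [massOf_zero]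
  refine ((continuousAt_clog ?_).tendsto.comp
    (tendsto_partitionFunction (coordAlpha z τ) (coordBeta z τ) τ)).neg
  rw [hZ]
  exact ofReal_mem_slitPlane.mpr hx

end MassiveTorus

theorem proposition3p3 (τ : ℍ) (z : ℂ) :
    (∀ μ : ℝ, 0 < μ →
      MassiveTorus.PartitionFunctionWellDefined (MassiveTorus.coordAlpha z τ)
        (MassiveTorus.coordBeta z τ) (MassiveTorus.massOf μ τ) τ ∧
      Summable (MassiveTorus.besselTerm μ z τ) ∧
      MassiveTorus.massiveE1 μ z τ =
        2 * (√(μ * τ.im) : ℂ) *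
          ∑' p : MassiveTorus.LatticeIndex, MassiveTorus.besselTerm μ z τ p) ∧
    ((∀ r ℓ : ℤ, z ≠ (r : ℂ) * (τ : ℂ) + (ℓ : ℂ)) →
      ∃ E : ℂ → ℂ, MassiveTorus.IsKroneckerEisenstein z τ E ∧
        Tendsto (fun μ : ℝ => MassiveTorus.massiveE1 μ z τ) (𝓝[>] 0) (𝓝 (E 1)) ∧
        MassiveTorus.PartitionFunctionWellDefined (MassiveTorus.coordAlpha z τ)
          (MassiveTorus.coordBeta z τ) 0 τ ∧
        MassiveTorus.massiveE1 0 z τ = E 1) := by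
  refine ⟨fun μ hμ => ⟨MassiveTorus.massive_wellDefined hμ _ _ τ,
    MassiveTorus.summable_besselTerm hμ z τ, ?_⟩, fun h => ?_⟩
  · rw [← tsum_mul_left, MassiveTorus.massiveE1_eq_tsum hμ]
    exact tsum_congr fun p => (MassiveTorus.bessel_eq_heatTerm hμ z τ p).symm
  · have hz : ∀ p : ℤ × ℤ, MassiveTorus.latticePoint τ p + z ≠ 0 := by
      intro p hp
      refine h (-p.1) (-p.2) ?_
      rw [MassiveTorus.latticePoint] at hp
      push_cast
      linear_combination hp
    have hlim := MassiveTorus.tendsto_massiveE1 z τ hz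
    refine ⟨_, MassiveTorus.isKroneckerEisenstein_mellin z τ hz, hlim,
      ⟨MassiveTorus.summable_casimirTerm _ _,
        (MassiveTorus.hasProd_fermionFactorPair _ _ _ _).multipliable, ?_⟩,
      tendsto_nhds_unique (MassiveTorus.tendsto_massiveE1_zero z τ hz) hlim⟩
    obtain ⟨x, hx, hZ⟩ := MassiveTorus.partitionFunction_zero_pos z τ hz
    rw [hZ]
    exact_mod_cast hx.ne'
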